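/- Let $C_1,C_2\in\mathbb C$, let $\varphi(z)=C_1\operatorname{Ai}(-2^{-1/3}z)+C_2\operatorname{Bi}(-2^{-1/3}z)$, where $\operatorname{Ai},\operatorname{Bi}$ are the standard Airy functions, and for $n\ge 1$ let $$\tau_n(z)=\det\Big(\tfrac{d^{j+k}}{dz^{j+k}}\varphi(z)\Big)_{j,k=0,\dots,n-1},\qquad K_n=\frac{2^{-\frac{3n^2}{4}-\frac n6}}{\pi^{n/2}},\qquad \psi_{n,r}(z)=(n-2r)\Big(\frac{\sqrt2\,z^{3/2}}{3}+\frac{n\pi}{4}\Big),$$ $$M_{n,r}=(-1)^{r(n-r)}\,2^{\frac52 r(n-r)}\,G(r+1)\,G(n-r+1),\qquad G(m)=\prod_{k=0}^{m-2}k!\quad(m\ge 1).$$ Then there are functions $\mathbf B_{n,r},\mathbf D_{n,r}:(0,\infty)\to\mathbb C$ and complex coefficients $b_{n,r}^{(j)},d_{n,r}^{(j)}$ ($n\ge1$, $0\le r\le n/2$, $j\ge 0$) such that for all $s\ge 1$ and all real $z>0$ $$\tau_{2s}(z)=K_{2s}\,z^{-s^2}\Big[\mathbf B_{2s,s}(z)+2\sum_{r=0}^{s-1}\big(\mathbf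 B_{2s,r}(z)\cos\psi_{2s,r}(z)+\mathbf D_{2s,r}(z)\sin\psi_{2s,r}(z)\big)\Big],$$ $$\tau_{2s-1}(z)=2K_{2s-1}\,z^{-\frac{(2s-1)^2}{4}}\sum_{r=0}^{s-1}\big(\mathbf B_{2s-1,r}(z)\cos\psi_{2s-1,r}(z)+\mathbf D_{2s-1,r}(z)\sin\psi_{2s-1,r}(z)\big),$$ and, for all $n\ge 1$ and $0\le r\le n/2$, in the sense of Poincaré asymptotic expansions as $z\to+\infty$, $$\mathbf B_{n,r}(z)\sim M_{n,r}\,z^{\frac32 r(n-r)}\sum_{j=0}^\infty\frac{b_{n,r}^{(j)}}{z^{3j/2}},\qquad \mathbf D_{n,r}(z)\sim M_{n,r}\,z^{\frac32 r(n-r)}\sum_{j=0}^\infty\frac{d_{n,r}^{(j)}}{z^{3j/2}}$$ (for every $N$, the error after the terms $j<N$ is $O(z^{\frac32 r(n-r)-\frac32 N})$), with leading coefficients $$b_{n,r}^{(0)}=\sum_{p=0}^{\lfloor n/2\rfloor}(-1)^pC_1^{2p}C_2^{n-2p}\sum_{q=\max(0,2p-r)}^{\min(2p,n-r)}(-1)^q\binom{r}{2p-q}\binom{n-r}{q},$$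 $$d_{n,r}^{(0)}=\sum_{p=0}^{\lceil n/2\rceil-1}(-1)^{p-1}C_1^{2p+1}C_2^{n-2p-1}\sum_{q=\max(0,2p+1-r)}^{\min(2p+1,n-r)}(-1)^q\binom{r}{2p+1-q}\binom{n-r}{q}.$$ -/

import Mathlib

/-- The integral of `exp (t ^ 3 / 3 - z * t)` over the ray from `0` to `∞ · ω`. It converges
absolutely for every `z` as soon as `Re (ω ^ 3) < 0`. -/
noncomputable def airyRay (ω z : ℂ) : ℂ :=
  ∫ t in Set.Ioi (0 : ℝ), Complex.exp ((ω * (t : ℂ)) ^ 3 / 3 - z * (ω * (t : ℂ))) * ω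

/-- The direction `e ^ (π i / 3)`. -/
noncomputable def dirUp : ℂ := Complex.exp (Real.pi * Complex.I / 3)

/-- The direction `e ^ (-π i / 3)`. -/
noncomputable def dirDown : ℂ := Complex.exp (-(Real.pi * Complex.I / 3))

/-- The Airy function `Ai z = (2 π i)⁻¹ ∫ exp (t ^ 3 / 3 - z t) dt`, along the path that comes
from `∞ e ^ (-π i / 3)` to `0` and goes on to `∞ e ^ (π i / 3)`. -/
noncomputable def airyAi (z : ℂ) : ℂ :=
  1 / (2 * Real.pi * Complex.I) * (airyRay dirUp z - airyRay dirDown z)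

/-- The Airy function `Bi z = (2 π)⁻¹ (∫ + ∫) exp (t ^ 3 / 3 - z t) dt`, along the two paths that
come from `-∞` to `0` and go on to `∞ e ^ (-π i / 3)`, respectively to `∞ e ^ (π i / 3)`. -/
noncomputable def airyBi (z : ℂ) : ℂ :=
  1 / (2 * Real.pi) *
    ((airyRay dirDown z - airyRay (-1) z) + (airyRay dirUp z - airyRay (-1) z))

/-- The seed function `φ(z) = C₁ Ai(-2 ^ (-1/3) z) + C₂ Bi(-2 ^ (-1/3) z)`. -/
noncomputable def airySeed (C₁ C₂ z : ℂ) : ℂ :=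
  C₁ * airyAi (-(((2 : ℝ) ^ (-(1 / 3) : ℝ) : ℝ) : ℂ) * z) +
    C₂ * airyBi (-(((2 : ℝ) ^ (-(1 / 3) : ℝ) : ℝ) : ℂ) * z)

/-- The tau function: the `n × n` Wronskian determinant with entries `φ ^ (j + k)`,
`0 ≤ j, k ≤ n - 1`, for the seed function `φ`. -/
noncomputable def airyTau (C₁ C₂ : ℂ) (n : ℕ) (z : ℂ) : ℂ :=
  Matrix.det (Matrix.of fun j k : Fin n =>
    iteratedDeriv ((j : ℕ) + (k : ℕ)) (airySeed C₁ C₂) z)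

/-- `K_n = 2 ^ (-3 n² / 4 - n / 6) / π ^ (n / 2)`. -/
noncomputable def tauConst (n : ℕ) : ℝ :=
  (2 : ℝ) ^ (-(3 * (n : ℝ) ^ 2 / 4) - (n : ℝ) / 6) / Real.pi ^ ((n : ℝ) / 2)

/-- The Barnes `G` function at a positive integer `n`: the product of `k!` for `0 ≤ k ≤ n - 2`
(so `G 1 = 1`). -/
def barnesG (n : ℕ) : ℕ := ∏ k ∈ Finset.range (n - 1), k.factorial

/-- The phase `ψ_{n,r}(z) = (n - 2 r) (√2 z ^ (3/2) / 3 + n π / 4)`. -/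
noncomputable def oscPhase (n r : ℕ) (z : ℝ) : ℝ :=
  ((n : ℝ) - 2 * (r : ℝ)) * (Real.sqrt 2 * z ^ (3 / 2 : ℝ) / 3 + (n : ℝ) * Real.pi / 4)

/-- `M_{n,r} = (-1) ^ (r (n - r)) 2 ^ (5 r (n - r) / 2) G(r + 1) G(n - r + 1)`, for `r ≤ n`. -/
noncomputable def oscConst (n r : ℕ) : ℝ :=
  (-1) ^ (r * (n - r)) * (2 : ℝ) ^ (5 / 2 * (r : ℝ) * ((n : ℝ) - (r : ℝ))) *
    (barnesG (r + 1) : ℝ) * (barnesG (n - r + 1) : ℝ)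

/-- The alternating sum of `(-1) ^ q (r choose m - q) (n - r choose q)` over
`max (0, m - r) ≤ q ≤ min (m, n - r)`, for `r ≤ n`
(the natural number subtraction `m - r` is `max (0, m - r)`). -/
def oscBinom (n r m : ℕ) : ℤ :=
  ∑ q ∈ Finset.Icc (m - r) (min m (n - r)),
    (-1) ^ q * (r.choose (m - q) : ℤ) * ((n - r).choose q : ℤ)

/-- The leading coefficient `b_{n,r}^{(0)}`; here `p` runs from `0` to `⌊n / 2⌋`. -/
noncomputable def oscB0 (C₁ C₂ : ℂ) (n r : ℕ) : ℂ :=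
  ∑ p ∈ Finset.range (n / 2 + 1),
    (-1) ^ p * C₁ ^ (2 * p) * C₂ ^ (n - 2 * p) * (oscBinom n r (2 * p) : ℂ)

/-- The leading coefficient `d_{n,r}^{(0)}`; here `p` runs from `0` to `⌈n / 2⌉ - 1`, that is, over
all `p` with `2 p + 1 ≤ n`, and the sign `(-1) ^ (p - 1)` is written as `(-1) ^ (p + 1)`. -/
noncomputable def oscD0 (C₁ C₂ : ℂ) (n r : ℕ) : ℂ :=
  ∑ p ∈ Finset.range ((n + 1) / 2),
    (-1) ^ (p + 1) * C₁ ^ (2 * p + 1) * C₂ ^ (n - (2 * p + 1)) *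
      (oscBinom n r (2 * p + 1) : ℂ)

/-- `f(z) ∼ M z ^ e ∑_{j ≥ 0} c_j z ^ (-3 j / 2)` as `z → +∞`, an asymptotic expansion in the sense
of Poincaré: the error after `N` terms is of the order of the first omitted power, for all `N`. -/
def HasOscExpansion (f : ℝ → ℂ) (M e : ℝ) (c : ℕ → ℂ) : Prop :=
  ∀ N : ℕ,
    Asymptotics.IsBigO Filter.atTop
      (fun z : ℝ => f z - (M : ℂ) * ((z ^ e : ℝ) : ℂ) *
        ∑ j ∈ Finset.range N, c j * ((z ^ (-(3 * (j : ℝ) / 2)) : ℝ) : ℂ))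
      (fun z : ℝ => z ^ (e - 3 * (N : ℝ) / 2))

/-!
The contour of `Ai (-x)`, `Bi (-x)` for `x > 0` splits into two pieces, one through each saddle point
`± i √x` of `t ^ 3 / 3 + x t`, and the pieces are complex conjugates of each other. So the
derivatives of the seed function are the moments of a functional `α L + β L'` on polynomials, where
`α = C₂ - i C₁`, `β = C₂ + i C₁` and `L' = conj L`, and `τ_n` is the Hankel determinant of that
functional. Expanding it by rows, `τ_n = ∑ r, α ^ (n - r) β ^ r P_r`, where `P_r` collects the terms
with `r` rows from `L'` (`pencilCoeff`, `det_smul_add_smul`, `airyTau_eq_sum_tauTerm`).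

The contour through `i √x` can be moved to the line through that point in direction `e ^ (π i / 6)`
(`upperMoment_eq`). On this line the integrand is exactly a Gaussian times a cubic exponential
`exp (i δ v ^ 3 / 3)` of modulus one, with `δ = x ^ (-3 / 4)`. Hence, after a phase and a power of
`x` are split off, the moments are smooth even functions of the real variable `δ`, and so is `P_r`.
Its Taylor polynomials at `δ = 0` give the asymptotic expansions (`exists_even_expansion`); evenness
makes the powers advance by `δ ^ 2`, which is a multiple of `z ^ (-3 / 2)`.

The order of vanishing of `P_r` and its leading coefficient come from a change of basis. With
`m = n - r ≥ r`, the Hankel matrices are written in the basis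
`(X + i) ^ b (X - i) ^ m` (`b < r`), `(X - i) ^ a (X + i) ^ r` (`a < m`), at the cost of the factor
`(-4) ^ (r m)` (`pencilCoeff_gramMatrix_hermiteBasis`). Suitably rescaled by powers of `δ`, the
matrix of `L` tends to one that is supported on the second block, and that of `L'` to one supported
on the first (`saddlePencil_eq_pow_mul`). So the limit is a product of two Hankel determinants of
Gaussian moments, which integration by parts evaluates (`det_hankel_of_derivative`): this is where
the Barnes functions come from. The terms `r` and `n - r` are conjugate up to the constants, and
together they give the cosine and the sine (`tauTerm_add_tauTerm`).
-/

/-! ### The bihomogeneous parts of the determinant of a matrix pencil -/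

section Pencil

variable {R : Type*} [CommRing R] {ι κ : Type*} [Fintype ι] [DecidableEq ι] [Fintype κ]
  [DecidableEq κ]

/-- The part of `det (α A + β B)` of degree `r` in `B`: the coefficient of `X ^ r` in
`det (A + X B)`. -/
noncomputable def pencilCoeff (r : ℕ) (A B : Matrix ι ι R) : R :=
  (Matrix.det (A.map Polynomial.C + (Polynomial.X : Polynomial R) • B.map Polynomial.C)).coeff r

/-- The matrix with the rows of `B` at the indices in `s` and the rows of `A` elsewhere. -/
def rowMix (s : Finset ι) (A B : Matrix ι ι R) : Matrix ι ι R :=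
  Matrix.of fun i j => if i ∈ s then B i j else A i j

theorem det_smul_add_smul_eq_sum_finset (α β : R) (A B : Matrix ι ι R) :
    (α • A + β • B).det =
      ∑ s : Finset ι, α ^ (Fintype.card ι - s.card) * β ^ s.card * (rowMix s A B).det := by
  have h := (Matrix.detRowAlternating (R := R) (n := ι)).map_add_univ (fun i => β • B i)
    (fun i => α • A i)
  rw [add_comm]
  refine h.trans (Finset.sum_congr rfl fun s _ => ?_)
  have h2 : (s.piecewise (fun i => β • B i) (fun i => α • A i) : ι → ι → R) =
      Matrix.of fun i j => (if i ∈ s then β else α) * rowMix s A B i j := by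
    funext i
    by_cases hi : i ∈ s <;> ext j <;> simp [hi, rowMix]
  rw [h2]
  refine (Matrix.det_mul_column _ _).trans ?_
  rw [Finset.prod_ite]
  congr 1
  simp [Finset.filter_notMem_eq_sdiff, Finset.card_univ_sdiff, mul_comm]

theorem pencilCoeff_eq_sum (r : ℕ) (A B : Matrix ι ι R) :
    pencilCoeff r A B = ∑ s ∈ Finset.powersetCard r Finset.univ, (rowMix s A B).det := by
  have h := det_smul_add_smul_eq_sum_finset (1 : Polynomial R) Polynomial.X
    (A.map Polynomial.C) (B.map Polynomial.C)
  rw [one_smul] at h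
  rw [pencilCoeff, h, Polynomial.finsetSum_coeff]
  have h3 : ∀ s : Finset ι, (rowMix s (A.map Polynomial.C) (B.map Polynomial.C)).det =
      Polynomial.C (rowMix s A B).det := by
    intro s
    rw [RingHom.map_det]
    congr 1
    ext i j : 2
    by_cases hi : i ∈ s <;> simp [rowMix, hi]
  simp_rw [h3, one_pow, one_mul, Polynomial.coeff_X_pow_mul', Polynomial.coeff_C]
  rw [Finset.powersetCard_eq_filter, Finset.powerset_univ, Finset.sum_filter]
  refine Finset.sum_congr rfl fun s _ => ?_
  split_ifs <;> first | rfl | omega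

theorem det_smul_add_smul (α β : R) (A B : Matrix ι ι R) :
    (α • A + β • B).det =
      ∑ r ∈ Finset.range (Fintype.card ι + 1),
        α ^ (Fintype.card ι - r) * β ^ r * pencilCoeff r A B := by
  rw [det_smul_add_smul_eq_sum_finset, ← Finset.powerset_univ, Finset.sum_powerset]
  refine Finset.sum_congr (by simp) fun r _ => ?_
  rw [pencilCoeff_eq_sum, Finset.mul_sum]
  refine Finset.sum_congr rfl fun s hs => ?_
  rw [(Finset.mem_powersetCard.1 hs).2]

/-- Complementation of the set of rows exchanges the two matrices. -/
theorem pencilCoeff_swap {r : ℕ} (hr : r ≤ Fintype.card ι) (A B : Matrix ι ι R) :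
    pencilCoeff (Fintype.card ι - r) A B = pencilCoeff r B A := by
  rw [pencilCoeff_eq_sum, pencilCoeff_eq_sum]
  refine Finset.sum_bij' (fun s _ => sᶜ) (fun s _ => sᶜ) ?_ ?_ ?_ ?_ ?_
  · intro s hs
    rw [Finset.mem_powersetCard] at hs ⊢
    refine ⟨Finset.subset_univ _, ?_⟩
    rw [Finset.card_compl]; omega
  · intro s hs
    rw [Finset.mem_powersetCard] at hs ⊢
    refine ⟨Finset.subset_univ _, ?_⟩
    rw [Finset.card_compl]; omega
  · simp
  · simp
  · intro s _
    congr 1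
    ext i j
    by_cases hi : i ∈ s <;> simp [rowMix, hi]

theorem pencilCoeff_conj_mul (r : ℕ) (M A B : Matrix ι ι R) :
    pencilCoeff r (M * A * M.transpose) (M * B * M.transpose) =
      M.det ^ 2 * pencilCoeff r A B := by
  have h : (M * A * M.transpose).map Polynomial.C +
      (Polynomial.X : Polynomial R) • (M * B * M.transpose).map Polynomial.C =
      M.map Polynomial.C * (A.map Polynomial.C +
        (Polynomial.X : Polynomial R) • B.map Polynomial.C) *
          (M.map Polynomial.C).transpose := by
    simp only [Matrix.map_mul, Matrix.mul_add, Matrix.add_mul, Matrix.mul_smul, Matrix.smul_mul,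
      Matrix.transpose_map]
  have h2 : (M.map (Polynomial.C : R →+* Polynomial R)).det = Polynomial.C M.det :=
    (RingHom.map_det Polynomial.C M).symm
  rw [pencilCoeff, h, Matrix.det_mul, Matrix.det_mul, Matrix.det_transpose, h2, mul_right_comm,
    ← Polynomial.C_mul, Polynomial.coeff_C_mul, pencilCoeff, sq]

theorem pencilCoeff_smul_right (r : ℕ) (t : R) (A B : Matrix ι ι R) :
    pencilCoeff r A (t • B) = t ^ r * pencilCoeff r A B := by
  rw [pencilCoeff_eq_sum, pencilCoeff_eq_sum, Finset.mul_sum]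
  refine Finset.sum_congr rfl fun s hs => ?_
  have h2 : rowMix s A (t • B) =
      Matrix.of fun i j => (if i ∈ s then t else 1) * rowMix s A B i j := by
    ext i j
    by_cases hi : i ∈ s <;> simp [rowMix, hi]
  rw [h2, Matrix.det_mul_column, Finset.prod_ite]
  simp [(Finset.mem_powersetCard.1 hs).2]

theorem pencilCoeff_map {S : Type*} [CommRing S] (f : R →+* S) (r : ℕ) (A B : Matrix ι ι R) :
    pencilCoeff r (A.map f) (B.map f) = f (pencilCoeff r A B) := by
  rw [pencilCoeff_eq_sum, pencilCoeff_eq_sum, map_sum]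
  refine Finset.sum_congr rfl fun s _ => ?_
  rw [RingHom.map_det]
  congr 1
  ext i j
  by_cases hi : i ∈ s <;> simp [rowMix, hi]

theorem pencilCoeff_submatrix (r : ℕ) (e : κ ≃ ι) (A B : Matrix ι ι R) :
    pencilCoeff r (A.submatrix e e) (B.submatrix e e) = pencilCoeff r A B := by
  have h : (A.submatrix e e).map Polynomial.C +
      (Polynomial.X : Polynomial R) • (B.submatrix e e).map Polynomial.C =
      (A.map Polynomial.C + (Polynomial.X : Polynomial R) • B.map Polynomial.C).submatrix e e := by
    ext i j
    simp
  rw [pencilCoeff, h, Matrix.det_submatrix_equiv_self, pencilCoeff]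

theorem pencilCoeff_fromBlocks (A : Matrix κ κ R) (B : Matrix ι ι R) :
    pencilCoeff (Fintype.card ι) (Matrix.fromBlocks (0 : Matrix ι ι R) 0 0 A)
      (Matrix.fromBlocks B 0 0 (0 : Matrix κ κ R)) = B.det * A.det := by
  have h : (Matrix.fromBlocks (0 : Matrix ι ι R) 0 0 A).map Polynomial.C +
      (Polynomial.X : Polynomial R) •
        (Matrix.fromBlocks B 0 0 (0 : Matrix κ κ R)).map Polynomial.C =
      Matrix.fromBlocks ((Polynomial.X : Polynomial R) • B.map Polynomial.C) 0 0
        (A.map Polynomial.C) := by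
    ext i j : 2
    rcases i with i | i <;> rcases j with j | j <;> simp
  have hA : (A.map (Polynomial.C : R →+* Polynomial R)).det = Polynomial.C A.det :=
    (RingHom.map_det Polynomial.C A).symm
  have hB : (B.map (Polynomial.C : R →+* Polynomial R)).det = Polynomial.C B.det :=
    (RingHom.map_det Polynomial.C B).symm
  rw [pencilCoeff, h, Matrix.det_fromBlocks_zero₂₁, Matrix.det_smul, hA, hB, mul_assoc,
    ← Polynomial.C_mul]
  have := Polynomial.coeff_X_pow_mul (Polynomial.C (B.det * A.det)) (Fintype.card ι) 0
  rw [zero_add] at this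
  rw [this, Polynomial.coeff_C_zero]

end Pencil

/-! ### Gram matrices of functionals on polynomials -/

section Gram

variable {R : Type*} [CommRing R] {ι : Type*} [Fintype ι]

/-- The Gram matrix of a family of polynomials for the bilinear form `(p, q) ↦ L (p q)`. -/
noncomputable def gramMatrix (L : Polynomial R →ₗ[R] R) (p : ι → Polynomial R) : Matrix ι ι R :=
  Matrix.of fun i j => L (p i * p j)

theorem gramMatrix_sum_smul (L : Polynomial R →ₗ[R] R) (M : Matrix ι ι R)
    (p q : ι → Polynomial R) (h : ∀ i, p i = ∑ j, M i j • q j) :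
    gramMatrix L p = M * gramMatrix L q * M.transpose := by
  ext i j
  simp only [gramMatrix, Matrix.of_apply, Matrix.mul_apply, Matrix.transpose_apply, h,
    Finset.sum_mul, Finset.mul_sum, map_sum, smul_mul_assoc, mul_smul_comm, map_smul, smul_eq_mul]
  refine Finset.sum_congr rfl fun k _ => Finset.sum_congr rfl fun l _ => ?_
  ring

theorem pencilCoeff_gramMatrix_of_sum_smul [DecidableEq ι] (r : ℕ) (L L' : Polynomial R →ₗ[R] R)
    (M : Matrix ι ι R) (p q : ι → Polynomial R) (h : ∀ i, p i = ∑ j, M i j • q j) :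
    pencilCoeff r (gramMatrix L p) (gramMatrix L' p) =
      M.det ^ 2 * pencilCoeff r (gramMatrix L q) (gramMatrix L' q) := by
  rw [gramMatrix_sum_smul L M p q h, gramMatrix_sum_smul L' M p q h, pencilCoeff_conj_mul]

open Polynomial in
/-- Monic polynomials of degrees `0, …, n - 1` have the same Gram determinants as the monomials. -/
theorem pencilCoeff_gramMatrix_monic {n : ℕ} [Nontrivial R] (r : ℕ) (L L' : R[X] →ₗ[R] R)
    (p : Fin n → R[X]) (hdeg : ∀ i, (p i).natDegree = i) (hmonic : ∀ i, (p i).Monic) :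
    pencilCoeff r (gramMatrix L p) (gramMatrix L' p) =
      pencilCoeff r (gramMatrix L fun i : Fin n => X ^ (i : ℕ))
        (gramMatrix L' fun i : Fin n => X ^ (i : ℕ)) := by
  have h := pencilCoeff_gramMatrix_of_sum_smul r L L'
    (Matrix.of (fun i j : Fin n => (p j).coeff i)).transpose p (fun i : Fin n => X ^ (i : ℕ)) ?_
  · rw [h, Matrix.det_transpose, Matrix.det_matrixOfPolynomials p hdeg hmonic]
    simp
  · intro i
    have h1 := (p i).as_sum_range' n (by rw [hdeg]; exact i.2)
    rw [← Fin.sum_univ_eq_sum_range (fun k => monomial k ((p i).coeff k))] at h1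
    refine h1.trans (Finset.sum_congr rfl fun j _ => ?_)
    simp [smul_X_eq_monomial]

open Polynomial in
/-- The basis of polynomials of degree less than `r + m` adapted to a zero of order `r` at `p` and
a zero of order `m` at `q`: multiples of `(X - q) ^ m` and multiples of `(X - p) ^ r`. -/
noncomputable def hermiteBasis (p q : R) (r m : ℕ) : Fin r ⊕ Fin m → R[X] :=
  Sum.elim (fun b => (X - C p) ^ (b : ℕ) * (X - C q) ^ m)
    (fun a => (X - C q) ^ (a : ℕ) * (X - C p) ^ r)

open Polynomial in
/-- The transition matrix from the powers of `X - p` to `hermiteBasis p q r m` is block triangular,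
with blocks that are triangular of determinant `(p - q) ^ (r m)` and `1`. -/
theorem pencilCoeff_gramMatrix_hermiteBasis [Nontrivial R] (p q : R) (r m k : ℕ)
    (L L' : R[X] →ₗ[R] R) :
    pencilCoeff k (gramMatrix L (hermiteBasis p q r m)) (gramMatrix L' (hermiteBasis p q r m)) =
      (p - q) ^ (2 * (r * m)) *
        pencilCoeff k (gramMatrix L fun i : Fin (r + m) => X ^ (i : ℕ))
          (gramMatrix L' fun i : Fin (r + m) => X ^ (i : ℕ)) := by
  have hmon := pencilCoeff_gramMatrix_monic k L L' (fun i : Fin (r + m) => (X - C p) ^ (i : ℕ))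
    (fun i => by rw [(monic_X_sub_C p).natDegree_pow]; simp)
    (fun i => (monic_X_sub_C p).pow _)
  rw [← hmon]
  set Q : Fin (r + m) → R[X] := fun i => (X - C p) ^ (i : ℕ)
  have hre : ∀ L : R[X] →ₗ[R] R, gramMatrix L (fun i : Fin r ⊕ Fin m => Q (finSumFinEquiv i)) =
      (gramMatrix L Q).submatrix finSumFinEquiv finSumFinEquiv := fun L => rfl
  set T : Fin r ⊕ Fin m → R[X] := fun i => taylor p (hermiteBasis p q r m i)
  have hTl : ∀ b, T (Sum.inl b) = X ^ (b : ℕ) * (X + C (p - q)) ^ m := by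
    intro b
    simp only [T, hermiteBasis, Sum.elim_inl, taylor_mul, taylor_pow, map_sub, taylor_X, taylor_C]
    ring
  have hTr : ∀ a, T (Sum.inr a) = X ^ r * (X + C (p - q)) ^ (a : ℕ) := by
    intro a
    simp only [T, hermiteBasis, Sum.elim_inr, taylor_mul, taylor_pow, map_sub, taylor_X, taylor_C]
    ring
  have hdegX : ∀ j : ℕ, ((X + C (p - q)) ^ j : R[X]).natDegree = j := by
    intro j
    rw [(monic_X_add_C _).natDegree_pow, natDegree_X_add_C, mul_one]
  have hTdeg : ∀ i, (T i).natDegree < r + m := by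
    rintro (b | a)
    · rw [hTl]
      refine lt_of_le_of_lt natDegree_mul_le ?_
      rw [hdegX, natDegree_X_pow]
      have := b.2; omega
    · rw [hTr]
      refine lt_of_le_of_lt natDegree_mul_le ?_
      rw [hdegX, natDegree_X_pow]
      have := a.2; omega
  set M : Matrix (Fin r ⊕ Fin m) (Fin r ⊕ Fin m) R :=
    Matrix.of fun i j => (T i).coeff (finSumFinEquiv j : Fin (r + m))
  have key := pencilCoeff_gramMatrix_of_sum_smul k L L' M (hermiteBasis p q r m)
    (fun i => Q (finSumFinEquiv i)) ?_
  · rw [key, hre, hre, pencilCoeff_submatrix]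
    congr 1
    rw [mul_comm 2, pow_mul]
    congr 1
    have hM : M = Matrix.fromBlocks
        (Matrix.of fun b b' : Fin r => (X ^ (b : ℕ) * (X + C (p - q)) ^ m : R[X]).coeff b')
        (Matrix.of fun (b : Fin r) (a : Fin m) =>
          (X ^ (b : ℕ) * (X + C (p - q)) ^ m : R[X]).coeff (r + a)) 0
        (Matrix.of fun a a' : Fin m => ((X + C (p - q)) ^ (a : ℕ) : R[X]).coeff a') := by
      ext i j
      rcases i with i | i <;> rcases j with j | j
      · simp only [M, Matrix.of_apply, hTl, Matrix.fromBlocks_apply₁₁, finSumFinEquiv_apply_left,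
          Fin.val_castAdd]
      · simp only [M, Matrix.of_apply, hTl, Matrix.fromBlocks_apply₁₂, finSumFinEquiv_apply_right,
          Fin.val_natAdd]
      · simp only [M, Matrix.of_apply, hTr, Matrix.fromBlocks_apply₂₁, finSumFinEquiv_apply_left,
          Fin.val_castAdd, Matrix.zero_apply, coeff_X_pow_mul']
        rw [if_neg (by have := j.2; omega)]
      · simp only [M, Matrix.of_apply, hTr, Matrix.fromBlocks_apply₂₂, finSumFinEquiv_apply_right,
          Fin.val_natAdd]
        rw [add_comm r, coeff_X_pow_mul]
    rw [hM, Matrix.det_fromBlocks_zero₂₁]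
    have h1 : (Matrix.of fun b b' : Fin r =>
        (X ^ (b : ℕ) * (X + C (p - q)) ^ m : R[X]).coeff b').det = (p - q) ^ (r * m) := by
      rw [Matrix.det_of_isUpperTriangular]
      · simp [coeff_X_pow_mul', coeff_zero_eq_eval_zero, mul_comm r, pow_mul]
      · intro b b' hb
        have hb' : b' < b := hb
        rw [Matrix.of_apply, coeff_X_pow_mul', if_neg (by simpa using hb')]
    have h2 : (Matrix.of fun a a' : Fin m =>
        ((X + C (p - q)) ^ (a : ℕ) : R[X]).coeff a').det = 1 := by
      rw [← Matrix.det_transpose]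
      exact Matrix.det_matrixOfPolynomials (fun i : Fin m => (X + C (p - q)) ^ (i : ℕ))
        (fun i => hdegX i) (fun i => (monic_X_add_C _).pow _)
    rw [h1, h2, mul_one]
  · intro i
    conv_lhs => rw [← sum_taylor_eq (hermiteBasis p q r m i) p]
    rw [sum_over_range' _ (by simp) (r + m) (hTdeg i),
      ← Fin.sum_univ_eq_sum_range (fun k => C ((T i).coeff k) * (X - C p) ^ k),
      ← finSumFinEquiv.sum_comp]
    refine Finset.sum_congr rfl fun j _ => ?_
    rw [smul_eq_C_mul]
    rfl

end Gram

section GaussHankel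

variable {K : Type*} [Field K]

open Polynomial in
/-- The monic orthogonal polynomials of a functional with `L (p') = c L (X p)`: the Hermite
polynomials, up to scaling. -/
noncomputable def gaussOrtho (c : K) : ℕ → K[X]
  | 0 => 1
  | k + 1 => X * gaussOrtho c k - C c⁻¹ * derivative (gaussOrtho c k)

open Polynomial in
theorem gaussOrtho_monic_natDegree (c : K) (k : ℕ) :
    (gaussOrtho c k).Monic ∧ (gaussOrtho c k).natDegree = k := by
  induction k with
  | zero => simp [gaussOrtho]
  | succ k ih =>
    obtain ⟨h1, h2⟩ := ih
    have hX : (X * gaussOrtho c k).Monic := monic_X.mul h1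
    have hd : (X * gaussOrtho c k).natDegree = k + 1 := by
      rw [monic_X.natDegree_mul h1, natDegree_X, h2, add_comm]
    have hlt : (C c⁻¹ * derivative (gaussOrtho c k)).degree < (X * gaussOrtho c k).degree := by
      rw [← smul_eq_C_mul]
      refine lt_of_le_of_lt (degree_smul_le _ _) ?_
      rw [degree_eq_natDegree hX.ne_zero, hd]
      refine lt_of_le_of_lt (degree_derivative_le) ?_
      rw [degree_eq_natDegree h1.ne_zero, h2]
      exact_mod_cast Nat.lt_succ_self k
    refine ⟨?_, ?_⟩
    · exact hX.sub_of_left hlt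
    · rw [gaussOrtho, natDegree_sub_eq_left_of_natDegree_lt, hd]
      rw [hd]
      refine lt_of_le_of_lt (natDegree_C_mul_le _ _) ?_
      refine lt_of_le_of_lt (natDegree_derivative_le _) ?_
      omega

open Polynomial in
/-- Repeated integration by parts. -/
theorem apply_gaussOrtho_mul (L : K[X] →ₗ[K] K) {c : K} (hc : c ≠ 0)
    (hL : ∀ p, L (derivative p) = c * L (X * p)) (k : ℕ) (p : K[X]) :
    L (gaussOrtho c k * p) = c⁻¹ ^ k * L (derivative^[k] p) := by
  induction k generalizing p with
  | zero => simp [gaussOrtho]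
  | succ k ih =>
    have h := hL (gaussOrtho c k * p)
    rw [derivative_mul, map_add] at h
    have e : gaussOrtho c (k + 1) * p =
        X * (gaussOrtho c k * p) - c⁻¹ • (derivative (gaussOrtho c k) * p) := by
      rw [gaussOrtho, smul_eq_C_mul]; ring
    rw [e, map_sub, map_smul, smul_eq_mul, Function.iterate_succ_apply, pow_succ, mul_right_comm,
      ← ih (derivative p)]
    field_simp
    linear_combination -h

open Polynomial in
theorem det_hankel_of_derivative (L : K[X] →ₗ[K] K) {c : K} (hc : c ≠ 0)
    (hL : ∀ p, L (derivative p) = c * L (X * p)) (m : ℕ) :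
    (Matrix.of fun i j : Fin m => L (X ^ ((i : ℕ) + (j : ℕ)))).det =
      L 1 ^ m * ∏ k ∈ Finset.range m, (c⁻¹ ^ k * (k.factorial : K)) := by
  have h0 := pencilCoeff_gramMatrix_monic 0 L 0 (fun i : Fin m => gaussOrtho c i)
    (fun i => (gaussOrtho_monic_natDegree c i).2) (fun i => (gaussOrtho_monic_natDegree c i).1)
  simp only [pencilCoeff_eq_sum, Finset.powersetCard_zero, Finset.sum_singleton,
    rowMix, Finset.notMem_empty, if_false] at h0
  have e1 : (Matrix.of fun i j : Fin m => L (X ^ ((i : ℕ) + (j : ℕ)))) =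
      gramMatrix L fun i : Fin m => X ^ (i : ℕ) := by
    ext i j
    simp [gramMatrix, pow_add]
  have e2 : gramMatrix L (fun i : Fin m => gaussOrtho c i) =
      Matrix.diagonal fun i : Fin m => L 1 * (c⁻¹ ^ (i : ℕ) * ((i : ℕ).factorial : K)) := by
    have hlt : ∀ i j : ℕ, j < i → L (gaussOrtho c i * gaussOrtho c j) = 0 := by
      intro i j hij
      rw [apply_gaussOrtho_mul L hc hL, iterate_derivative_eq_zero, map_zero, mul_zero]
      rwa [(gaussOrtho_monic_natDegree c j).2]
    ext i j
    rw [gramMatrix, Matrix.of_apply]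
    rcases lt_trichotomy i j with h | h | h
    · rw [Matrix.diagonal_apply_ne _ h.ne, mul_comm]
      exact hlt _ _ h
    · subst h
      rw [Matrix.diagonal_apply_eq, apply_gaussOrtho_mul L hc hL]
      have h3 : derivative^[(i : ℕ)] (gaussOrtho c i) = ((i : ℕ).factorial : K) • 1 := by
        have hd := (gaussOrtho_monic_natDegree c i).2
        have h4 : (derivative^[(i : ℕ)] (gaussOrtho c i)).natDegree = 0 := by
          have := natDegree_iterate_derivative (gaussOrtho c i) i
          omega
        rw [eq_C_of_natDegree_eq_zero h4, coeff_iterate_derivative, zero_add]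
        have h5 : (gaussOrtho c i).coeff (i : ℕ) = 1 := by
          have := (gaussOrtho_monic_natDegree c i).1
          rwa [Monic, leadingCoeff, hd] at this
        rw [h5, Nat.descFactorial_self, smul_eq_C_mul]
        simp
      rw [h3, map_smul, smul_eq_mul]
      ring
    · rw [Matrix.diagonal_apply_ne' _ h.ne]
      exact hlt _ _ h
  have e3 : (gramMatrix L fun i : Fin m => X ^ (i : ℕ)).det =
      (gramMatrix L fun i : Fin m => gaussOrtho c i).det := h0.symm
  rw [e1, e3, e2, Matrix.det_diagonal, Finset.prod_mul_distrib,
    Fin.prod_univ_eq_prod_range (fun k => c⁻¹ ^ k * (k.factorial : K))]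
  simp

end GaussHankel

/-! ### The cubic perturbation of a complex Gaussian integral -/

/-- The direction `e ^ (π i / 6)`. -/
noncomputable def dirSixth : ℂ := Complex.exp (Real.pi * Complex.I / 6)

theorem dirSixth_eq : dirSixth = (Real.sqrt 3 + Complex.I) / 2 := by
  rw [dirSixth, show (Real.pi * Complex.I / 6 : ℂ) = ((Real.pi / 6 : ℝ) : ℂ) * Complex.I by
    push_cast; ring, Complex.exp_mul_I, ← Complex.ofReal_cos, ← Complex.ofReal_sin,
    Real.cos_pi_div_six, Real.sin_pi_div_six]
  push_cast
  ring

theorem sqrt_three_sq_complex : ((Real.sqrt 3 : ℝ) : ℂ) ^ 2 = 3 := by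
  rw [← Complex.ofReal_pow, Real.sq_sqrt (by norm_num)]
  norm_num

theorem dirSixth_pow_three : dirSixth ^ 3 = Complex.I := by
  rw [dirSixth_eq]
  linear_combination (Real.sqrt 3 / 8 + 3 * Complex.I / 8 : ℂ) * sqrt_three_sq_complex +
    (3 * Real.sqrt 3 / 8 + Complex.I / 8 : ℂ) * Complex.I_sq

theorem dirSixth_ne_zero : dirSixth ≠ 0 := Complex.exp_ne_zero _

theorem dirSixth_inv : dirSixth⁻¹ = (Real.sqrt 3 - Complex.I) / 2 := by
  refine inv_eq_of_mul_eq_one_right ?_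
  rw [dirSixth_eq]
  linear_combination (1 / 4 : ℂ) * sqrt_three_sq_complex - (1 / 4 : ℂ) * Complex.I_sq

/-- The weight `exp (-ω⁻¹ v ^ 2 + i δ v ^ 3 / 3)` for `ω = e ^ (π i / 6)`: the exponential of the
Airy phase along the line in direction `ω` through its saddle point, in rescaled coordinates. -/
noncomputable def cubicGauss (δ v : ℝ) : ℂ :=
  Complex.exp (-dirSixth⁻¹ * (v : ℂ) ^ 2 + Complex.I * δ * (v : ℂ) ^ 3 / 3)

theorem norm_cubicGauss (δ v : ℝ) :
    ‖cubicGauss δ v‖ = Real.exp (-(Real.sqrt 3 / 2) * v ^ 2) := by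
  rw [cubicGauss, Complex.norm_exp, dirSixth_inv]
  congr 1
  have : (-((Real.sqrt 3 - Complex.I) / 2) * (v : ℂ) ^ 2 + Complex.I * δ * (v : ℂ) ^ 3 / 3 : ℂ) =
      ((-(Real.sqrt 3 / 2) * v ^ 2 : ℝ) : ℂ) + ((v ^ 2 / 2 + δ * v ^ 3 / 3 : ℝ) : ℂ) *
        Complex.I := by
    push_cast; ring
  rw [this]
  simp only [Complex.add_re, Complex.re_ofReal_mul, Complex.I_re, Complex.ofReal_re]
  ring

theorem continuous_cubicGauss (δ : ℝ) : Continuous (cubicGauss δ) := by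
  unfold cubicGauss
  fun_prop

theorem hasDerivAt_cubicGauss_param (δ v : ℝ) :
    HasDerivAt (fun δ : ℝ => cubicGauss δ v)
      (Complex.I / 3 * (v : ℂ) ^ 3 * cubicGauss δ v) δ := by
  have h : HasDerivAt (fun δ : ℝ =>
      (-dirSixth⁻¹ * (v : ℂ) ^ 2 + Complex.I * (δ : ℂ) * (v : ℂ) ^ 3 / 3 : ℂ))
      (Complex.I * 1 * (v : ℂ) ^ 3 / 3) δ :=
    ((((Complex.ofRealCLM.hasDerivAt (x := δ)).const_mul Complex.I).mul_const _).div_const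
      _).const_add _
  convert! h.cexp using 1
  rw [cubicGauss]
  ring

theorem cubicGauss_neg (δ v : ℝ) : cubicGauss (-δ) v = cubicGauss δ (-v) := by
  rw [cubicGauss, cubicGauss]
  congr 1
  push_cast
  ring

open Polynomial in
theorem integrable_eval_mul_cubicGauss (δ : ℝ) (p : ℂ[X]) :
    MeasureTheory.Integrable fun v : ℝ => p.eval (v : ℂ) * cubicGauss δ v := by
  induction p using Polynomial.induction_on' with
  | add p q hp hq =>
    simp only [eval_add, add_mul]
    exact hp.add hq
  | monomial n a =>
    have h := integrable_rpow_mul_exp_neg_mul_sq (b := Real.sqrt 3 / 2) (by positivity)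
      (s := (n : ℝ)) (by have : (0 : ℝ) ≤ n := n.cast_nonneg; linarith)
    have h2 : MeasureTheory.Integrable fun v : ℝ => (v : ℂ) ^ n * cubicGauss δ v := by
      refine h.mono ?_ (Filter.Eventually.of_forall fun v => ?_)
      · have := continuous_cubicGauss δ
        exact Continuous.aestronglyMeasurable (by fun_prop)
      · rw [norm_mul, norm_cubicGauss, norm_mul, Real.rpow_natCast, norm_pow, norm_pow,
          Complex.norm_real, Real.norm_of_nonneg (Real.exp_pos _).le]
    simpa only [eval_monomial, mul_assoc] using h2.const_mul a

open Polynomial in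
/-- The functional `p ↦ ∫ p(v) exp (-ω⁻¹ v ^ 2 + i δ v ^ 3 / 3) dv`. -/
noncomputable def cubicGaussFunctional (δ : ℝ) : ℂ[X] →ₗ[ℂ] ℂ where
  toFun p := ∫ v : ℝ, p.eval (v : ℂ) * cubicGauss δ v
  map_add' p q := by
    simp only [eval_add, add_mul]
    exact MeasureTheory.integral_add (integrable_eval_mul_cubicGauss δ p)
      (integrable_eval_mul_cubicGauss δ q)
  map_smul' c p := by
    simp only [eval_smul, smul_eq_mul, mul_assoc, RingHom.id_apply]
    exact MeasureTheory.integral_const_mul _ _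

open Polynomial in
theorem hasDerivAt_cubicGaussFunctional (p : ℂ[X]) (δ : ℝ) :
    HasDerivAt (fun δ => cubicGaussFunctional δ p)
      (Complex.I / 3 * cubicGaussFunctional δ (X ^ 3 * p)) δ := by
  obtain ⟨q, hq⟩ : ∃ q : ℂ[X], q = C (Complex.I / 3) * (X ^ 3 * p) := ⟨_, rfl⟩
  have hd : ∀ v x : ℝ, HasDerivAt (fun δ : ℝ => p.eval (v : ℂ) * cubicGauss δ v)
      (q.eval (v : ℂ) * cubicGauss x v) x := by
    intro v x
    convert! (hasDerivAt_cubicGauss_param x v).const_mul (p.eval (v : ℂ)) using 1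
    simp only [hq, eval_mul, eval_C, eval_pow, eval_X]
    ring
  have h := hasDerivAt_integral_of_dominated_loc_of_deriv_le
    (μ := (MeasureTheory.volume : MeasureTheory.Measure ℝ))
    (F := fun (δ : ℝ) (v : ℝ) => p.eval (v : ℂ) * cubicGauss δ v)
    (F' := fun (δ : ℝ) (v : ℝ) => q.eval (v : ℂ) * cubicGauss δ v)
    (x₀ := δ) (s := Set.univ) (bound := fun v => ‖q.eval (v : ℂ) * cubicGauss 0 v‖)
    Filter.univ_mem
    (Filter.Eventually.of_forall fun δ => (integrable_eval_mul_cubicGauss δ p).1)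
    (integrable_eval_mul_cubicGauss δ p) (integrable_eval_mul_cubicGauss δ q).1
    (Filter.Eventually.of_forall fun v x _ => by
      rw [norm_mul, norm_mul, norm_cubicGauss, norm_cubicGauss])
    (integrable_eval_mul_cubicGauss 0 q).norm
    (Filter.Eventually.of_forall fun v x _ => hd v x)
  convert! h.2 using 1
  have h2 : cubicGaussFunctional δ q = Complex.I / 3 * cubicGaussFunctional δ (X ^ 3 * p) := by
    rw [hq, ← smul_eq_C_mul, map_smul, smul_eq_mul]
  exact h2.symm

open Polynomial in
theorem contDiff_cubicGaussFunctional (n : ℕ) (p : ℂ[X]) :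
    ContDiff ℝ n fun δ => cubicGaussFunctional δ p := by
  induction n generalizing p with
  | zero =>
    exact contDiff_zero.2 (continuous_iff_continuousAt.2 fun δ =>
      (hasDerivAt_cubicGaussFunctional p δ).continuousAt)
  | succ n ih =>
    push_cast
    refine contDiff_succ_iff_deriv.2 ⟨fun δ =>
      (hasDerivAt_cubicGaussFunctional p δ).differentiableAt, by simp, ?_⟩
    rw [show deriv (fun δ => cubicGaussFunctional δ p) =
      fun δ => Complex.I / 3 * cubicGaussFunctional δ (X ^ 3 * p) from
      funext fun δ => (hasDerivAt_cubicGaussFunctional p δ).deriv]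
    exact contDiff_const.mul (ih _)

open Polynomial in
theorem contDiff_cubicGaussFunctional_pow_mul (n : ℕ) (a c : ℂ) (k : ℕ) (q : ℂ[X]) :
    ContDiff ℝ n fun δ : ℝ => cubicGaussFunctional δ ((C a + C (c * δ) * X) ^ k * q) := by
  induction k generalizing q with
  | zero => simpa using contDiff_cubicGaussFunctional n q
  | succ k ih =>
    have h : ∀ δ : ℝ, cubicGaussFunctional δ ((C a + C (c * δ) * X) ^ (k + 1) * q) =
        a * cubicGaussFunctional δ ((C a + C (c * δ) * X) ^ k * q) +
          c * (δ : ℂ) * cubicGaussFunctional δ ((C a + C (c * δ) * X) ^ k * (X * q)) := by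
      intro δ
      rw [← smul_eq_mul (a := c * (δ : ℂ)), ← smul_eq_mul (a := a) (b := cubicGaussFunctional δ _),
        ← map_smul, ← map_smul, ← map_add]
      congr 1
      rw [smul_eq_C_mul, smul_eq_C_mul]
      ring
    simp only [h]
    exact (contDiff_const.mul (ih q)).add
      ((contDiff_const.mul Complex.ofRealCLM.contDiff).mul (ih (X * q)))

open Polynomial in
theorem cubicGaussFunctional_neg (δ : ℝ) (p : ℂ[X]) :
    cubicGaussFunctional (-δ) p = cubicGaussFunctional δ (p.comp (-X)) := by
  change ∫ v : ℝ, _ = ∫ v : ℝ, _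
  rw [← MeasureTheory.integral_neg_eq_self]
  refine MeasureTheory.integral_congr_ae (Filter.Eventually.of_forall fun v => ?_)
  simp [cubicGauss_neg, eval_comp]

open Polynomial in
/-- Integration by parts against the Gaussian weight. -/
theorem cubicGaussFunctional_zero_derivative (p : ℂ[X]) :
    cubicGaussFunctional 0 (derivative p) =
      2 * dirSixth⁻¹ * cubicGaussFunctional 0 (X * p) := by
  have hd : ∀ v : ℝ, HasDerivAt (fun v : ℝ => p.eval (v : ℂ) * cubicGauss 0 v)
      ((derivative p - C (2 * dirSixth⁻¹) * (X * p)).eval (v : ℂ) * cubicGauss 0 v) v := by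
    intro v
    have h1 : HasDerivAt (fun v : ℝ => p.eval (v : ℂ)) ((derivative p).eval (v : ℂ)) v :=
      (p.hasDerivAt (v : ℂ)).comp_ofReal
    have h2 : HasDerivAt (fun v : ℝ => cubicGauss 0 v)
        (cubicGauss 0 v * (-dirSixth⁻¹ * (2 * (v : ℂ)))) v := by
      have h3 : HasDerivAt (fun v : ℂ => Complex.exp (-dirSixth⁻¹ * v ^ 2))
          (Complex.exp (-dirSixth⁻¹ * (v : ℂ) ^ 2) * (-dirSixth⁻¹ * (2 * (v : ℂ)))) (v : ℂ) := by
        simpa using ((hasDerivAt_pow 2 (v : ℂ)).const_mul (-dirSixth⁻¹)).cexp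
      have h4 := h3.comp_ofReal
      have e : ∀ v : ℝ, cubicGauss 0 v = Complex.exp (-dirSixth⁻¹ * (v : ℂ) ^ 2) := by
        intro v; simp [cubicGauss]
      simpa only [e] using h4
    convert! h1.mul h2 using 1
    simp only [eval_sub, eval_mul, eval_C, eval_X]
    ring
  have h := MeasureTheory.integral_eq_zero_of_hasDerivAt_of_integrable hd
    (integrable_eval_mul_cubicGauss 0 _) (integrable_eval_mul_cubicGauss 0 _)
  have h2 : cubicGaussFunctional 0 (derivative p - C (2 * dirSixth⁻¹) * (X * p)) = 0 := h
  rwa [map_sub, ← smul_eq_C_mul, map_smul, smul_eq_mul, sub_eq_zero] at h2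

theorem dirSixth_mul_cubicGaussFunctional_one :
    dirSixth * cubicGaussFunctional 0 1 =
      Real.sqrt Real.pi * Complex.exp (Real.pi * Complex.I / 4) := by
  have h1 : cubicGaussFunctional 0 1 = (Real.pi / dirSixth⁻¹ : ℂ) ^ (1 / 2 : ℂ) := by
    rw [← integral_gaussian_complex]
    · change ∫ v : ℝ, _ = ∫ v : ℝ, _
      refine MeasureTheory.integral_congr_ae (Filter.Eventually.of_forall fun v => ?_)
      simp [cubicGauss]
    · rw [dirSixth_inv]
      simp
  have h2 : (Real.pi / dirSixth⁻¹ : ℂ) =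
      Complex.exp ((Real.log Real.pi : ℝ) + ((Real.pi / 6 : ℝ) : ℂ) * Complex.I) := by
    rw [Complex.exp_add, ← Complex.ofReal_exp, Real.exp_log Real.pi_pos, div_inv_eq_mul, dirSixth]
    congr 2
    push_cast; ring
  have hpi := Real.pi_pos
  rw [h1, Complex.cpow_def_of_ne_zero (by rw [h2]; exact Complex.exp_ne_zero _), h2,
    Complex.log_exp (by simp; linarith) (by simp; linarith)]
  have h3 : (Real.sqrt Real.pi : ℂ) = Complex.exp ((Real.log Real.pi : ℝ) / 2) := by
    rw [Real.sqrt_eq_rpow, Real.rpow_def_of_pos hpi, Complex.ofReal_exp]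
    congr 1
    push_cast; ring
  rw [h3, dirSixth, ← Complex.exp_add, ← Complex.exp_add]
  congr 1
  push_cast
  ring

open Polynomial in
/-- The functional `p ↦ ω ∫ p(i + ω δ v) exp (-ω⁻¹ v ^ 2 + i δ v ^ 3 / 3) dv`, where
`ω = e ^ (π i / 6)`: the contribution of the saddle point `i`. -/
noncomputable def saddleFunctional (δ : ℝ) : ℂ[X] →ₗ[ℂ] ℂ :=
  dirSixth • (cubicGaussFunctional δ ∘ₗ
    (aeval (C Complex.I + C (dirSixth * δ) * X : ℂ[X])).toLinearMap)

open Polynomial in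
theorem saddleFunctional_apply (δ : ℝ) (p : ℂ[X]) :
    saddleFunctional δ p =
      dirSixth * cubicGaussFunctional δ (aeval (C Complex.I + C (dirSixth * δ) * X : ℂ[X]) p) :=
  rfl

open Polynomial in
theorem saddleFunctional_neg (δ : ℝ) (p : ℂ[X]) :
    saddleFunctional (-δ) p = saddleFunctional δ p := by
  rw [saddleFunctional_apply, saddleFunctional_apply, cubicGaussFunctional_neg]
  congr 2
  rw [comp_eq_aeval, ← aeval_algHom_apply]
  congr 1
  simp only [map_add, map_mul, aeval_C, aeval_X, algebraMap_eq, Complex.ofReal_neg, map_neg]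
  ring_nf

open Polynomial in
theorem contDiff_saddleFunctional_X_pow (n k : ℕ) :
    ContDiff ℝ n fun δ => saddleFunctional δ (X ^ k) := by
  have h := contDiff_cubicGaussFunctional_pow_mul n Complex.I dirSixth k 1
  simp only [saddleFunctional_apply, map_pow, aeval_X]
  simp only [mul_one] at h
  exact contDiff_const.mul h

/-! ### Moments of the Airy integrand along rays -/

/-- The integral of `t ^ k exp (t ^ 3 / 3 - z t)` over the ray from `0` to `∞ · ω`. -/
noncomputable def rayMoment (ω : ℂ) (k : ℕ) (z : ℂ) : ℂ :=
  ∫ t in Set.Ioi (0 : ℝ),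
    (ω * (t : ℂ)) ^ k * (Complex.exp ((ω * (t : ℂ)) ^ 3 / 3 - z * (ω * (t : ℂ))) * ω)

theorem rayMoment_zero (ω : ℂ) : rayMoment ω 0 = airyRay ω := by
  funext z
  simp [rayMoment, airyRay]

theorem norm_eq_one_of_pow_three {ω : ℂ} (hω : ω ^ 3 = -1) : ‖ω‖ = 1 := by
  have h : ‖ω‖ ^ 3 = 1 := by rw [← norm_pow, hω]; simp
  exact (pow_eq_one_iff_of_nonneg (norm_nonneg _) (by norm_num)).1 h

theorem norm_exp_airyPhase_le {ω z : ℂ} (hω : ω ^ 3 = -1) {R t : ℝ} (hz : ‖z‖ ≤ R) (ht : 0 ≤ t) :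
    ‖Complex.exp ((ω * (t : ℂ)) ^ 3 / 3 - z * (ω * (t : ℂ)))‖ ≤
      Real.exp (4 / 3 + (R + 1) ^ 2 / 4) * Real.exp (-t) := by
  rw [Complex.norm_exp, ← Real.exp_add, Real.exp_le_exp, Complex.sub_re]
  have h1 : ((ω * (t : ℂ)) ^ 3 / 3).re = -(t ^ 3 / 3) := by
    rw [mul_pow, hω, show (-1 * (t : ℂ) ^ 3 / 3 : ℂ) = ((-(t ^ 3 / 3) : ℝ) : ℂ) by
      push_cast; ring, Complex.ofReal_re]
  have h2 : -(z * (ω * (t : ℂ))).re ≤ R * t := by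
    refine (neg_le_abs _).trans ((Complex.abs_re_le_norm _).trans ?_)
    rw [norm_mul, norm_mul, norm_eq_one_of_pow_three hω, Complex.norm_real,
      Real.norm_of_nonneg ht, one_mul]
    exact mul_le_mul_of_nonneg_right hz ht
  rw [h1]
  -- `t ^ 3 / 3 ≥ t ^ 2 - 4 / 3`, because `t ^ 3 - 3 t ^ 2 + 4 = (t - 2) ^ 2 (t + 1)`
  nlinarith [mul_nonneg (sq_nonneg (t - 2)) (by linarith : (0 : ℝ) ≤ t + 1),
    sq_nonneg (t - (R + 1) / 2)]

theorem integrableOn_pow_mul_exp_neg (k : ℕ) :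
    MeasureTheory.IntegrableOn (fun t : ℝ => t ^ k * Real.exp (-t)) (Set.Ioi 0) := by
  have h := Real.GammaIntegral_convergent (s := (k : ℝ) + 1) (Nat.cast_add_one_pos k)
  refine h.congr_fun (fun t _ => ?_) measurableSet_Ioi
  simp [mul_comm]

theorem norm_rayIntegrand_le {ω z : ℂ} (hω : ω ^ 3 = -1) {R t : ℝ} (hz : ‖z‖ ≤ R) (ht : 0 ≤ t)
    (k : ℕ) :
    ‖(ω * (t : ℂ)) ^ k * (Complex.exp ((ω * (t : ℂ)) ^ 3 / 3 - z * (ω * (t : ℂ))) * ω)‖ ≤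
      Real.exp (4 / 3 + (R + 1) ^ 2 / 4) * (t ^ k * Real.exp (-t)) := by
  rw [norm_mul, norm_mul, norm_pow, norm_mul, norm_eq_one_of_pow_three hω, Complex.norm_real,
    Real.norm_of_nonneg ht, one_mul, mul_one, mul_left_comm (Real.exp _)]
  exact mul_le_mul_of_nonneg_left (norm_exp_airyPhase_le hω hz ht) (pow_nonneg ht k)

theorem integrableOn_rayIntegrand {ω : ℂ} (hω : ω ^ 3 = -1) (z : ℂ) (k : ℕ) :
    MeasureTheory.IntegrableOn (fun t : ℝ => (ω * (t : ℂ)) ^ k *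
      (Complex.exp ((ω * (t : ℂ)) ^ 3 / 3 - z * (ω * (t : ℂ))) * ω)) (Set.Ioi 0) := by
  refine MeasureTheory.Integrable.mono'
    ((integrableOn_pow_mul_exp_neg k).const_mul (Real.exp (4 / 3 + (‖z‖ + 1) ^ 2 / 4)))
    (Continuous.aestronglyMeasurable (by fun_prop)) ?_
  rw [MeasureTheory.ae_restrict_iff' measurableSet_Ioi]
  exact Filter.Eventually.of_forall fun t ht =>
    norm_rayIntegrand_le hω le_rfl (le_of_lt ht) k

theorem hasDerivAt_rayMoment {ω : ℂ} (hω : ω ^ 3 = -1) (k : ℕ) (z : ℂ) :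
    HasDerivAt (rayMoment ω k) (-rayMoment ω (k + 1) z) z := by
  have hd : ∀ (t : ℝ) (w : ℂ), HasDerivAt (fun w => (ω * (t : ℂ)) ^ k *
      (Complex.exp ((ω * (t : ℂ)) ^ 3 / 3 - w * (ω * (t : ℂ))) * ω))
      (-((ω * (t : ℂ)) ^ (k + 1) *
        (Complex.exp ((ω * (t : ℂ)) ^ 3 / 3 - w * (ω * (t : ℂ))) * ω))) w := by
    intro t w
    have h : HasDerivAt (fun w : ℂ => (ω * (t : ℂ)) ^ 3 / 3 - w * (ω * (t : ℂ)))
        (-(1 * (ω * (t : ℂ)))) w := ((hasDerivAt_id w).mul_const _).const_sub _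
    convert! (h.cexp.mul_const ω).const_mul ((ω * (t : ℂ)) ^ k) using 1
    ring
  have h := hasDerivAt_integral_of_dominated_loc_of_deriv_le
    (μ := MeasureTheory.volume.restrict (Set.Ioi (0 : ℝ)))
    (F := fun (w : ℂ) (t : ℝ) => (ω * (t : ℂ)) ^ k *
      (Complex.exp ((ω * (t : ℂ)) ^ 3 / 3 - w * (ω * (t : ℂ))) * ω))
    (F' := fun (w : ℂ) (t : ℝ) => -((ω * (t : ℂ)) ^ (k + 1) *
      (Complex.exp ((ω * (t : ℂ)) ^ 3 / 3 - w * (ω * (t : ℂ))) * ω)))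
    (x₀ := z) (s := Metric.ball z 1)
    (bound := fun t : ℝ => Real.exp (4 / 3 + ((‖z‖ + 1) + 1) ^ 2 / 4) *
      (t ^ (k + 1) * Real.exp (-t)))
    (Metric.ball_mem_nhds z one_pos)
    (Filter.Eventually.of_forall fun w => (integrableOn_rayIntegrand hω w k).1)
    (integrableOn_rayIntegrand hω z k)
    (integrableOn_rayIntegrand hω z (k + 1)).1.neg
    (by
      rw [MeasureTheory.ae_restrict_iff' measurableSet_Ioi]
      refine Filter.Eventually.of_forall fun t ht w hw => ?_
      rw [norm_neg]
      refine norm_rayIntegrand_le hω ?_ (le_of_lt ht) (k + 1)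
      have h1 : ‖w - z‖ < 1 := by rwa [← dist_eq_norm]
      have h2 := norm_add_le (w - z) z
      rw [sub_add_cancel] at h2
      linarith)
    ((integrableOn_pow_mul_exp_neg (k + 1)).const_mul _)
    (Filter.Eventually.of_forall fun t w _ => hd t w)
  have h2 := h.2
  rw [MeasureTheory.integral_neg] at h2
  exact h2

/-! ### The contour through one saddle point -/

theorem dirUp_eq : dirUp = (1 + Real.sqrt 3 * Complex.I) / 2 := by
  rw [dirUp, show (Real.pi * Complex.I / 3 : ℂ) = ((Real.pi / 3 : ℝ) : ℂ) * Complex.I by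
    push_cast; ring, Complex.exp_mul_I, ← Complex.ofReal_cos, ← Complex.ofReal_sin,
    Real.cos_pi_div_three, Real.sin_pi_div_three]
  push_cast
  ring

theorem dirUp_pow_three : dirUp ^ 3 = -1 := by
  rw [dirUp, ← Complex.exp_nat_mul, ← Complex.exp_pi_mul_I]
  congr 1
  push_cast
  ring

theorem dirDown_eq_conj : dirDown = (starRingEnd ℂ) dirUp := by
  rw [dirDown, dirUp, ← Complex.exp_conj]
  congr 1
  simp [neg_div, map_ofNat]

theorem dirDown_pow_three : dirDown ^ 3 = -1 := by
  rw [dirDown_eq_conj, ← map_pow, dirUp_pow_three]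
  simp

theorem rayMoment_conj (ω : ℂ) (k : ℕ) (y : ℝ) :
    rayMoment ((starRingEnd ℂ) ω) k y = (starRingEnd ℂ) (rayMoment ω k y) := by
  rw [rayMoment, rayMoment, ← integral_conj]
  congr 1
  funext t
  simp [← Complex.exp_conj, map_ofNat]

/-- The `k`-th moment of the Airy integrand at `-x` along the contour from `-∞` through `0` to
`∞ e ^ (π i / 3)`. -/
noncomputable def upperMoment (k : ℕ) (x : ℝ) : ℂ :=
  rayMoment dirUp k (-x) - rayMoment (-1) k (-x)

theorem conj_upperMoment (k : ℕ) (x : ℝ) :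
    (starRingEnd ℂ) (upperMoment k x) = rayMoment dirDown k (-x) - rayMoment (-1) k (-x) := by
  have h1 := rayMoment_conj dirUp k (-x)
  have h2 := rayMoment_conj (-1) k (-x)
  rw [← dirDown_eq_conj] at h1
  simp only [map_neg, map_one] at h2
  push_cast at h1 h2
  rw [upperMoment, map_sub, h1, ← h2]

theorem tendsto_primitive_ray {ω : ℂ} (hω : ω ^ 3 = -1) (k : ℕ) (x : ℝ) {F : ℂ → ℂ}
    (hF : ∀ t, HasDerivAt F (t ^ k * Complex.exp (t ^ 3 / 3 + x * t)) t) :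
    Filter.Tendsto (fun T : ℝ => F (ω * T) - F 0) Filter.atTop
      (nhds (rayMoment ω k (-x))) := by
  have h := MeasureTheory.intervalIntegral_tendsto_integral_Ioi (0 : ℝ)
    (integrableOn_rayIntegrand hω (-x) k) Filter.tendsto_id
  refine h.congr fun T => ?_
  have hd : ∀ t : ℝ, HasDerivAt (fun t : ℝ => F (ω * t)) ((ω * (t : ℂ)) ^ k *
      (Complex.exp ((ω * (t : ℂ)) ^ 3 / 3 - (-x : ℂ) * (ω * (t : ℂ))) * ω)) t := by
    intro t
    have h1 : HasDerivAt (fun t : ℝ => ω * (t : ℂ)) (ω * 1) t :=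
      (Complex.ofRealCLM.hasDerivAt (x := t)).const_mul ω
    convert! HasDerivAt.comp t (hF (ω * t)) h1 using 1
    ring_nf
  rw [intervalIntegral.integral_eq_sub_of_hasDerivAt (fun t _ => hd t)
    (Continuous.intervalIntegrable (by fun_prop) _ _)]
  simp

theorem norm_primitive_vertical_le {F f : ℂ → ℂ} (hF : ∀ t, HasDerivAt F (f t) t) (X Y₁ Y₂ M : ℝ)
    (hY : Y₁ ≤ Y₂) (hM : ∀ Y ∈ Set.Icc Y₁ Y₂, ‖f (X + Y * Complex.I)‖ ≤ M) :
    ‖F (X + Y₂ * Complex.I) - F (X + Y₁ * Complex.I)‖ ≤ M * (Y₂ - Y₁) := by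
  have hd : ∀ Y : ℝ, HasDerivAt (fun Y : ℝ => F (X + Y * Complex.I))
      (f (X + Y * Complex.I) * Complex.I) Y := by
    intro Y
    have h1 : HasDerivAt (fun Y : ℝ => (X : ℂ) + Y * Complex.I) (1 * Complex.I) Y :=
      ((Complex.ofRealCLM.hasDerivAt (x := Y)).mul_const Complex.I).const_add _
    convert! HasDerivAt.comp Y (hF (X + Y * Complex.I)) h1 using 1
    ring
  refine norm_image_sub_le_of_norm_deriv_le_segment' (fun Y _ => (hd Y).hasDerivWithinAt)
    (fun Y hY' => ?_) Y₂ (Set.right_mem_Icc.2 hY)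
  rw [norm_mul, Complex.norm_I, mul_one]
  exact hM Y ⟨hY'.1, hY'.2.le⟩

theorem norm_airyIntegrand_le (k : ℕ) {X Y x N E : ℝ} (hN : |X| + |Y| ≤ N)
    (hE : X ^ 3 / 3 - X * Y ^ 2 + x * X ≤ E) :
    ‖((X : ℂ) + Y * Complex.I) ^ k * Complex.exp (((X : ℂ) + Y * Complex.I) ^ 3 / 3 +
      x * ((X : ℂ) + Y * Complex.I))‖ ≤ N ^ k * Real.exp E := by
  rw [norm_mul, norm_pow, Complex.norm_exp]
  have h1 : ‖(X : ℂ) + Y * Complex.I‖ ≤ N := by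
    refine (norm_add_le _ _).trans ?_
    simpa using hN
  have h2 : (((X : ℂ) + Y * Complex.I) ^ 3 / 3 + x * ((X : ℂ) + Y * Complex.I)).re =
      X ^ 3 / 3 - X * Y ^ 2 + x * X := by
    have : (((X : ℂ) + Y * Complex.I) ^ 3 / 3 + x * ((X : ℂ) + Y * Complex.I)) =
        ((X ^ 3 / 3 - X * Y ^ 2 + x * X : ℝ) : ℂ) +
          ((X ^ 2 * Y - Y ^ 3 / 3 + x * Y : ℝ) : ℂ) * Complex.I := by
      push_cast
      linear_combination (X * Y ^ 2 + Y ^ 3 * Complex.I / 3 : ℂ) * Complex.I_sq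
    rw [this]
    simp only [Complex.add_re, Complex.ofReal_re, Complex.re_ofReal_mul, Complex.I_re, mul_zero,
      add_zero]
  rw [h2]
  exact mul_le_mul (pow_le_pow_left₀ (norm_nonneg _) h1 k) (Real.exp_le_exp.2 hE)
    (Real.exp_pos _).le (pow_nonneg ((norm_nonneg _).trans h1) k)

theorem tendsto_pow_mul_exp_neg_sq_add {a : ℝ} (ha : 0 < a) (x : ℝ) (k : ℕ) :
    Filter.Tendsto (fun X : ℝ => (4 * X) ^ k * Real.exp (-a * X ^ 2 + x * X)) Filter.atTop
      (nhds 0) := by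
  have h := (Real.tendsto_pow_mul_exp_neg_atTop_nhds_zero k).const_mul ((4 : ℝ) ^ k)
  rw [mul_zero] at h
  refine squeeze_zero' ?_ ?_ h
  · filter_upwards [Filter.eventually_ge_atTop (0 : ℝ)] with X hX
    positivity
  · filter_upwards [Filter.eventually_ge_atTop (0 : ℝ),
      Filter.eventually_ge_atTop ((x + 1) / a)] with X hX hX2
    rw [mul_pow, mul_assoc]
    have h1 : x + 1 ≤ X * a := (div_le_iff₀ ha).1 hX2
    have h2 : -a * X ^ 2 + x * X ≤ -X := by nlinarith
    gcongr

/-- The contour from `-∞` to `∞ e ^ (π i / 3)` may be replaced by the line in direction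
`e ^ (π i / 6)` through the saddle point `i κ ^ 2`; there the integrand is a Gaussian times a
factor of modulus one. -/
theorem upperMoment_eq {κ : ℝ} (hκ : 0 < κ) (k : ℕ) :
    upperMoment k (κ ^ 4) = (κ : ℂ)⁻¹ * (κ : ℂ) ^ (2 * k) *
      Complex.exp (2 * Complex.I * κ ^ 6 / 3) *
        saddleFunctional (κ⁻¹ ^ 3) (Polynomial.X ^ k) := by
  have hκ0 : (κ : ℂ) ≠ 0 := by exact_mod_cast hκ.ne'
  obtain ⟨F, hF'⟩ := Differentiable.isExactOn_univ
    (f := fun t : ℂ => t ^ k * Complex.exp (t ^ 3 / 3 + (κ ^ 4 : ℝ) * t)) (by fun_prop)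
  have hF : ∀ t, HasDerivAt F (t ^ k * Complex.exp (t ^ 3 / 3 + (κ ^ 4 : ℝ) * t)) t :=
    fun t => hF' t (Set.mem_univ t)
  clear hF'
  have hray := (((tendsto_primitive_ray dirUp_pow_three k _ hF).comp
    (Filter.tendsto_id.const_mul_atTop (two_pos (α := ℝ)))).sub
    (tendsto_primitive_ray (ω := -1) (by norm_num) k _ hF))
  -- the integral over the line as a limit of increments of the primitive
  set γ : ℝ → ℂ := fun v => Complex.I * κ ^ 2 + dirSixth * (κ : ℂ)⁻¹ * v
  set A : ℂ := (κ : ℂ)⁻¹ * (κ : ℂ) ^ (2 * k) * Complex.exp (2 * Complex.I * κ ^ 6 / 3) * dirSixth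
  set p : Polynomial ℂ := Polynomial.aeval
    (Polynomial.C Complex.I + Polynomial.C (dirSixth * (κ⁻¹ ^ 3 : ℝ)) * Polynomial.X)
    (Polynomial.X ^ k : Polynomial ℂ)
  have hγ : ∀ v : ℝ, HasDerivAt (fun v : ℝ => F (γ v))
      (A * (p.eval (v : ℂ) * cubicGauss (κ⁻¹ ^ 3) v)) v := by
    intro v
    have h1 : HasDerivAt γ (dirSixth * (κ : ℂ)⁻¹ * 1) v :=
      ((Complex.ofRealCLM.hasDerivAt (x := v)).const_mul (dirSixth * (κ : ℂ)⁻¹)).const_add _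
    convert! HasDerivAt.comp v (hF (γ v)) h1 using 1
    have e1 : γ v = (κ : ℂ) ^ 2 * (Complex.I + dirSixth * (κ⁻¹ ^ 3 : ℝ) * v) := by
      simp only [γ]
      push_cast
      field_simp
    have e2 : (γ v) ^ 3 / 3 + (κ ^ 4 : ℝ) * γ v = 2 * Complex.I * κ ^ 6 / 3 +
        (-dirSixth⁻¹ * (v : ℂ) ^ 2 + Complex.I * (κ⁻¹ ^ 3 : ℝ) * (v : ℂ) ^ 3 / 3) := by
      have e3 : dirSixth⁻¹ = -Complex.I * dirSixth ^ 2 := by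
        have h0 := dirSixth_ne_zero
        rw [inv_eq_iff_eq_inv]
        refine eq_inv_of_mul_eq_one_left ?_
        linear_combination -Complex.I * dirSixth_pow_three - Complex.I_sq
      rw [e3]
      simp only [γ]
      push_cast
      have hi : (κ : ℂ) * (κ : ℂ)⁻¹ = 1 := mul_inv_cancel₀ hκ0
      linear_combination (Complex.I / 3 * κ ^ 6 + κ ^ 4 * dirSixth * (κ : ℂ)⁻¹ * v) * Complex.I_sq +
        Complex.I * dirSixth ^ 2 * v ^ 2 * (κ * (κ : ℂ)⁻¹ + 1) * hi +
        (κ : ℂ)⁻¹ ^ 3 * v ^ 3 / 3 * dirSixth_pow_three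
    rw [e2, Complex.exp_add, e1, mul_pow, ← pow_mul]
    simp only [A, p, cubicGauss, map_pow, Polynomial.aeval_X, Polynomial.eval_pow,
      Polynomial.eval_add, Polynomial.eval_mul, Polynomial.eval_C, Polynomial.eval_X]
    ring
  have hint : MeasureTheory.Integrable fun v : ℝ =>
      A * (p.eval (v : ℂ) * cubicGauss (κ⁻¹ ^ 3) v) :=
    (integrable_eval_mul_cubicGauss _ p).const_mul A
  have hline := MeasureTheory.intervalIntegral_tendsto_integral hint
    Filter.tendsto_neg_atTop_atBot Filter.tendsto_id
  have hline2 : Filter.Tendsto (fun v : ℝ => F (γ v) - F (γ (-v))) Filter.atTop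
      (nhds (A * cubicGaussFunctional (κ⁻¹ ^ 3) p)) := by
    have e : A * cubicGaussFunctional (κ⁻¹ ^ 3) p =
        ∫ v : ℝ, A * (p.eval (v : ℂ) * cubicGauss (κ⁻¹ ^ 3) v) :=
      (MeasureTheory.integral_const_mul _ _).symm
    rw [e]
    refine hline.congr fun v => ?_
    exact intervalIntegral.integral_eq_sub_of_hasDerivAt (fun t _ => hγ t)
      hint.intervalIntegrable
  have hs3 : (0 : ℝ) < Real.sqrt 3 := by positivity
  have hs3' : Real.sqrt 3 ^ 2 = 3 := Real.sq_sqrt (by norm_num)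
  have hline3 := hline2.comp (Filter.tendsto_id.const_mul_atTop
    (show (0 : ℝ) < 2 * κ / Real.sqrt 3 by positivity))
  set h : ℝ := κ ^ 2
  have hh : 0 < h := by positivity
  have hx : κ ^ 4 = h ^ 2 := by simp only [h]; ring
  set q : ℝ := (Real.sqrt 3)⁻¹
  have hq : 0 < q := by positivity
  have hq2 : q ^ 2 * 3 = 1 := by
    rw [← hs3', ← mul_pow, inv_mul_cancel₀ hs3.ne', one_pow]
  have hs3q : Real.sqrt 3 = 3 * q := by
    have h1 : Real.sqrt 3 * q = 1 := mul_inv_cancel₀ hs3.ne'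
    linear_combination -Real.sqrt 3 * h1 + q * hs3'
  have hq1 : q ≤ 1 := by nlinarith
  have hlim := tendsto_pow_mul_exp_neg_sq_add (a := 2 * h * q) (by positivity) (κ ^ 4) (k + 1)
  -- the ends of the line and of the contour are joined by vertical segments, on which the integrand
  -- is at most `(4 X) ^ k exp (-2 h q X ^ 2 + κ ^ 4 X)`
  have hright : Filter.Tendsto (fun X : ℝ => F (X + (Real.sqrt 3 * X : ℝ) * Complex.I) -
      F (X + (h + q * X : ℝ) * Complex.I)) Filter.atTop (nhds 0) := by
    refine squeeze_zero_norm' ?_ hlim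
    filter_upwards [Filter.eventually_ge_atTop (0 : ℝ), Filter.eventually_ge_atTop (h / q)] with
      X hX hX2
    have h1 : h ≤ X * q := (div_le_iff₀ hq).1 hX2
    have hqX : q * X ≤ X := mul_le_of_le_one_left hX hq1
    refine (norm_primitive_vertical_le hF X (h + q * X) (Real.sqrt 3 * X)
      ((4 * X) ^ k * Real.exp (-(2 * h * q) * X ^ 2 + κ ^ 4 * X)) (by rw [hs3q]; nlinarith)
      fun Y hY => norm_airyIntegrand_le k (N := 4 * X) ?_ ?_).trans ?_
    · have hY0 : 0 ≤ Y := le_trans (by positivity) hY.1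
      have := hY.2
      rw [abs_of_nonneg hX, abs_of_nonneg hY0]
      rw [hs3q] at this
      nlinarith
    · have h2 : (h + q * X) ^ 2 ≤ Y ^ 2 := pow_le_pow_left₀ (by positivity) hY.1 2
      have h3 := mul_le_mul_of_nonneg_left h2 hX
      have h4 : X * (h + q * X) ^ 2 = h ^ 2 * X + 2 * h * q * X ^ 2 + X ^ 3 / 3 := by
        linear_combination X ^ 3 / 3 * hq2
      have h5 : 0 ≤ h ^ 2 * X := by positivity
      linarith
    · rw [pow_succ (4 * X) k, mul_right_comm]
      refine mul_le_mul_of_nonneg_right (mul_le_mul_of_nonneg_left ?_ (by positivity))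
        (Real.exp_pos _).le
      rw [hs3q]
      nlinarith
  have hleft : Filter.Tendsto (fun X : ℝ => F ((-X : ℝ) + (0 : ℝ) * Complex.I) -
      F ((-X : ℝ) + (h - q * X : ℝ) * Complex.I)) Filter.atTop (nhds 0) := by
    refine squeeze_zero_norm' ?_ hlim
    filter_upwards [Filter.eventually_ge_atTop (0 : ℝ), Filter.eventually_ge_atTop (h / q)] with
      X hX hX2
    have h1 : h ≤ X * q := (div_le_iff₀ hq).1 hX2
    have hqX : q * X ≤ X := mul_le_of_le_one_left hX hq1
    refine (norm_primitive_vertical_le hF (-X) (h - q * X) 0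
      ((4 * X) ^ k * Real.exp (-(2 * h * q) * X ^ 2 + κ ^ 4 * X)) (by linarith)
      fun Y hY => norm_airyIntegrand_le k (N := 4 * X) ?_ ?_).trans ?_
    · have := hY.1
      rw [abs_neg, abs_of_nonneg hX, abs_of_nonpos hY.2]
      linarith
    · have h2 : (-Y) ^ 2 ≤ (q * X - h) ^ 2 :=
        pow_le_pow_left₀ (by linarith [hY.2]) (by linarith [hY.1]) 2
      have h3 := mul_le_mul_of_nonneg_left h2 hX
      have h4 : X * (q * X - h) ^ 2 = h ^ 2 * X - 2 * h * q * X ^ 2 + X ^ 3 / 3 := by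
        linear_combination X ^ 3 / 3 * hq2
      have h5 : 0 ≤ h ^ 2 * X := by positivity
      rw [hx]
      linarith
    · rw [pow_succ (4 * X) k, mul_right_comm]
      refine mul_le_mul_of_nonneg_right (mul_le_mul_of_nonneg_left ?_ (by positivity))
        (Real.exp_pos _).le
      linarith
  have hsq := sqrt_three_sq_complex
  have hs3c : ((Real.sqrt 3 : ℝ) : ℂ) ≠ 0 := by exact_mod_cast hs3.ne'
  have hfin := (hline3.add hright).sub hleft
  rw [add_zero, sub_zero] at hfin
  have huniq := tendsto_nhds_unique (hray.congr fun X => ?_) hfin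
  · rw [upperMoment, ← Complex.ofReal_neg] at *
    rw [saddleFunctional_apply]
    refine Eq.trans ?_ (huniq.trans ?_)
    · rfl
    · simp only [A]
      ring
  · have e1 : γ (2 * κ / Real.sqrt 3 * X) = X + (h + q * X : ℝ) * Complex.I := by
      simp only [γ, dirSixth_eq, h, q]
      push_cast
      field_simp
      ring
    have e2 : γ (-(2 * κ / Real.sqrt 3 * X)) = (-X : ℝ) + (h - q * X : ℝ) * Complex.I := by
      simp only [γ, dirSixth_eq, h, q]
      push_cast
      field_simp
      ring
    have e3 : dirUp * ((2 * X : ℝ) : ℂ) = X + (Real.sqrt 3 * X : ℝ) * Complex.I := by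
      rw [dirUp_eq]
      push_cast
      ring
    have e4 : (-1 : ℂ) * (X : ℂ) = (-X : ℝ) + (0 : ℝ) * Complex.I := by
      push_cast
      ring
    simp only [Function.comp_apply, id, e1, e2, e3, e4]
    ring

/-! ### Derivatives of the seed function -/

theorem airySeed_eq (C₁ C₂ z : ℂ) :
    airySeed C₁ C₂ z = 1 / (2 * Real.pi) *
      ((C₂ - Complex.I * C₁) *
        (rayMoment dirUp 0 (-(((2 : ℝ) ^ (-(1 / 3) : ℝ) : ℝ) : ℂ) * z) -
          rayMoment (-1) 0 (-(((2 : ℝ) ^ (-(1 / 3) : ℝ) : ℝ) : ℂ) * z)) +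
      (C₂ + Complex.I * C₁) *
        (rayMoment dirDown 0 (-(((2 : ℝ) ^ (-(1 / 3) : ℝ) : ℝ) : ℂ) * z) -
          rayMoment (-1) 0 (-(((2 : ℝ) ^ (-(1 / 3) : ℝ) : ℝ) : ℂ) * z))) := by
  rw [airySeed, airyAi, airyBi, rayMoment_zero, rayMoment_zero, rayMoment_zero]
  have h : (1 / (2 * Real.pi * Complex.I) : ℂ) = 1 / (2 * Real.pi) * -Complex.I := by
    rw [one_div_mul_eq_div, ← Complex.inv_I, inv_eq_one_div, div_div, mul_comm Complex.I]
  rw [h]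
  ring

/-- The `k`-th derivative of the seed function in terms of moments along rays. -/
theorem iteratedDeriv_airySeed (C₁ C₂ : ℂ) (k : ℕ) :
    iteratedDeriv k (airySeed C₁ C₂) = fun z =>
      (((2 : ℝ) ^ (-(1 / 3) : ℝ) : ℝ) : ℂ) ^ k * (1 / (2 * Real.pi) *
      ((C₂ - Complex.I * C₁) *
        (rayMoment dirUp k (-(((2 : ℝ) ^ (-(1 / 3) : ℝ) : ℝ) : ℂ) * z) -
          rayMoment (-1) k (-(((2 : ℝ) ^ (-(1 / 3) : ℝ) : ℝ) : ℂ) * z)) +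
      (C₂ + Complex.I * C₁) *
        (rayMoment dirDown k (-(((2 : ℝ) ^ (-(1 / 3) : ℝ) : ℝ) : ℂ) * z) -
          rayMoment (-1) k (-(((2 : ℝ) ^ (-(1 / 3) : ℝ) : ℝ) : ℂ) * z)))) := by
  set c : ℂ := (((2 : ℝ) ^ (-(1 / 3) : ℝ) : ℝ) : ℂ)
  induction k with
  | zero =>
    funext z
    rw [iteratedDeriv_zero, airySeed_eq, pow_zero, one_mul]
  | succ k ih =>
    rw [iteratedDeriv_succ, ih]
    funext z
    have hd : ∀ {ω : ℂ}, ω ^ 3 = -1 → HasDerivAt (fun z => rayMoment ω k (-c * z))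
        (-rayMoment ω (k + 1) (-c * z) * (-c * 1)) z := fun hω =>
      (hasDerivAt_rayMoment hω k (-c * z)).comp z ((hasDerivAt_id z).const_mul (-c))
    have h1 := hd dirUp_pow_three
    have h2 := hd dirDown_pow_three
    have h3 := hd (ω := -1) (by norm_num)
    refine HasDerivAt.deriv ?_
    convert! ((((h1.sub h3).const_mul (C₂ - Complex.I * C₁)).add
      ((h2.sub h3).const_mul (C₂ + Complex.I * C₁))).const_mul (1 / (2 * Real.pi) : ℂ)).const_mul
        (c ^ k) using 1
    ring

theorem iteratedDeriv_airySeed_ofReal (C₁ C₂ : ℂ) (k : ℕ) (z : ℝ) :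
    iteratedDeriv k (airySeed C₁ C₂) (z : ℂ) =
      (((2 : ℝ) ^ (-(1 / 3) : ℝ) : ℝ) : ℂ) ^ k * (1 / (2 * Real.pi) *
      ((C₂ - Complex.I * C₁) * upperMoment k ((2 : ℝ) ^ (-(1 / 3) : ℝ) * z) +
      (C₂ + Complex.I * C₁) *
        (starRingEnd ℂ) (upperMoment k ((2 : ℝ) ^ (-(1 / 3) : ℝ) * z)))) := by
  rw [iteratedDeriv_airySeed, conj_upperMoment, upperMoment]
  simp only [Complex.ofReal_mul, neg_mul]

/-! ### The pencil spanned by the two saddle points -/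

section SaddlePencil

open Polynomial

/-- The Hankel matrix of the moments of the contribution of the saddle point `i`. -/
noncomputable def saddleHankel (n : ℕ) (δ : ℝ) : Matrix (Fin n) (Fin n) ℂ :=
  gramMatrix (saddleFunctional δ) fun i : Fin n => X ^ (i : ℕ)

/-- The part of the Hankel determinant of the two saddle points in which `n - r` rows come from the
saddle point `i` and `r` rows from the saddle point `-i`. -/
noncomputable def saddlePencil (n r : ℕ) (δ : ℝ) : ℂ :=
  pencilCoeff r (saddleHankel n δ) ((saddleHankel n δ).map (starRingEnd ℂ))

theorem saddlePencil_sub (n r : ℕ) (hr : r ≤ n) (δ : ℝ) :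
    saddlePencil n (n - r) δ = (starRingEnd ℂ) (saddlePencil n r δ) := by
  have h := pencilCoeff_swap (r := r) (by simpa using hr) (saddleHankel n δ)
    ((saddleHankel n δ).map (starRingEnd ℂ))
  rw [Fintype.card_fin] at h
  rw [saddlePencil, h, saddlePencil, ← pencilCoeff_map]
  congr 1
  ext i j
  simp

theorem saddlePencil_neg (n r : ℕ) (δ : ℝ) : saddlePencil n r (-δ) = saddlePencil n r δ := by
  have h : saddleHankel n (-δ) = saddleHankel n δ := by
    ext i j
    simp [saddleHankel, gramMatrix, saddleFunctional_neg]
  rw [saddlePencil, h, saddlePencil]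

theorem contDiff_saddlePencil (k n r : ℕ) : ContDiff ℝ k (saddlePencil n r) := by
  have h : ∀ i j : Fin n, ContDiff ℝ k fun δ => saddleHankel n δ i j := by
    intro i j
    simp only [saddleHankel, gramMatrix, Matrix.of_apply, ← pow_add]
    exact contDiff_saddleFunctional_X_pow k _
  have h2 : ∀ i j : Fin n, ContDiff ℝ k fun δ => (starRingEnd ℂ) (saddleHankel n δ i j) :=
    fun i j => Complex.conjCLE.contDiff.comp (h i j)
  unfold saddlePencil
  simp only [pencilCoeff_eq_sum, Matrix.det_apply, rowMix, Matrix.of_apply, Matrix.map_apply]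
  refine ContDiff.sum fun s _ => ContDiff.sum fun σ _ => ContDiff.const_smul _ ?_
  refine contDiff_prod fun i _ => ?_
  split_ifs
  · exact h2 _ _
  · exact h _ _

/-- The functional `p ↦ conj (L (conj p))`. -/
noncomputable def conjFunctional (L : ℂ[X] →ₗ[ℂ] ℂ) : ℂ[X] →ₗ[ℂ] ℂ where
  toFun p := (starRingEnd ℂ) (L (p.map (starRingEnd ℂ)))
  map_add' p q := by simp
  map_smul' c p := by
    rw [smul_eq_C_mul, Polynomial.map_mul, map_C, ← smul_eq_C_mul, map_smul]
    simp

theorem conjFunctional_apply (L : ℂ[X] →ₗ[ℂ] ℂ) (p : ℂ[X]) :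
    conjFunctional L p = (starRingEnd ℂ) (L (p.map (starRingEnd ℂ))) := rfl

/-- The moments of the saddle point `i` with respect to products of powers of the linear forms that
vanish at the two saddle points, without the power of `δ` by which they are small. -/
noncomputable def saddleMoment (k l : ℕ) (δ : ℝ) : ℂ :=
  dirSixth ^ (k + 1) *
    cubicGaussFunctional δ ((C (2 * Complex.I) + C (dirSixth * δ) * X) ^ l * X ^ k)

theorem continuous_saddleMoment (k l : ℕ) : Continuous (saddleMoment k l) :=
  continuous_const.mul (contDiff_cubicGaussFunctional_pow_mul 0 _ _ _ _).continuous

theorem saddleFunctional_pow_mul_pow (k l : ℕ) (δ : ℝ) :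
    saddleFunctional δ ((X - C Complex.I) ^ k * (X - C (-Complex.I)) ^ l) =
      (δ : ℂ) ^ k * saddleMoment k l δ := by
  rw [saddleFunctional_apply, saddleMoment]
  have h : aeval (C Complex.I + C (dirSixth * δ) * X : ℂ[X])
      ((X - C Complex.I) ^ k * (X - C (-Complex.I)) ^ l) =
      ((dirSixth * δ) ^ k) • ((C (2 * Complex.I) + C (dirSixth * δ) * X) ^ l * X ^ k) := by
    simp only [map_mul, map_pow, map_sub, aeval_X, aeval_C, algebraMap_eq, smul_eq_C_mul]
    rw [show (C Complex.I + C dirSixth * C (δ : ℂ) * X - C Complex.I : ℂ[X]) =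
        C dirSixth * C (δ : ℂ) * X by ring,
      show (C Complex.I + C dirSixth * C (δ : ℂ) * X - C (-Complex.I) : ℂ[X]) =
        C 2 * C Complex.I + C dirSixth * C (δ : ℂ) * X by
          rw [C_neg, show (C 2 : ℂ[X]) = 2 from map_ofNat C 2]; ring]
    ring
  rw [h, map_smul, smul_eq_mul]
  ring

theorem conjFunctional_saddleFunctional_pow_mul_pow (k l : ℕ) (δ : ℝ) :
    conjFunctional (saddleFunctional δ) ((X - C Complex.I) ^ k * (X - C (-Complex.I)) ^ l) =
      (δ : ℂ) ^ l * (starRingEnd ℂ) (saddleMoment l k δ) := by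
  rw [conjFunctional_apply]
  have h : ((X - C Complex.I) ^ k * (X - C (-Complex.I)) ^ l : ℂ[X]).map (starRingEnd ℂ) =
      (X - C Complex.I) ^ l * (X - C (-Complex.I)) ^ k := by
    simp only [Polynomial.map_mul, Polynomial.map_pow, Polynomial.map_sub, map_X, map_C,
      Complex.conj_I, Polynomial.map_neg, map_neg, neg_neg]
    ring
  rw [h, saddleFunctional_pow_mul_pow]
  simp

/-- The order of vanishing at `i` of the members of the adapted basis. -/
def ordUp (r m : ℕ) : Fin r ⊕ Fin m → ℕ := Sum.elim (fun _ => m) (fun a => a)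

/-- The order of vanishing at `-i` of the members of the adapted basis. -/
def ordDown (r m : ℕ) : Fin r ⊕ Fin m → ℕ := Sum.elim (fun b => b) (fun _ => r)

theorem hermiteBasis_eq (r m : ℕ) (i : Fin r ⊕ Fin m) :
    hermiteBasis (-Complex.I) Complex.I r m i =
      (X - C Complex.I) ^ ordUp r m i * (X - C (-Complex.I)) ^ ordDown r m i := by
  rcases i with b | a
  · simp only [hermiteBasis, ordUp, ordDown, Sum.elim_inl]
    ring
  · simp only [hermiteBasis, ordUp, ordDown, Sum.elim_inr]

/-- The Gram matrix of the saddle point `i` in the adapted basis, after division of each basis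
element by `δ ^ scaleExp`. -/
noncomputable def scaledUp (r m : ℕ) (δ : ℝ) : Matrix (Fin r ⊕ Fin m) (Fin r ⊕ Fin m) ℂ :=
  Matrix.of fun i j =>
    (δ : ℂ) ^ (Sum.elim (fun b : Fin r => r - (b : ℕ)) (fun _ => 0) i +
      Sum.elim (fun b : Fin r => r - (b : ℕ)) (fun _ => 0) j) *
      saddleMoment (ordUp r m i + ordUp r m j) (ordDown r m i + ordDown r m j) δ

/-- The Gram matrix of the saddle point `-i` in the adapted basis, multiplied by `δ ^ (2 (m - r))`,
after division of each basis element by `δ ^ scaleExp`. -/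
noncomputable def scaledDown (r m : ℕ) (δ : ℝ) : Matrix (Fin r ⊕ Fin m) (Fin r ⊕ Fin m) ℂ :=
  Matrix.of fun i j =>
    (δ : ℂ) ^ (Sum.elim (fun _ => 0) (fun a : Fin m => m - (a : ℕ)) i +
      Sum.elim (fun _ => 0) (fun a : Fin m => m - (a : ℕ)) j) *
      (starRingEnd ℂ)
        (saddleMoment (ordDown r m i + ordDown r m j) (ordUp r m i + ordUp r m j) δ)

/-- The exponents of `δ` by which the members of the adapted basis are rescaled. The natural orders
`b` and `a` alone would leave negative powers of `δ` in the Gram matrix of `-i`; shifting weight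
`m - r` from the second pencil variable to the first block removes them. -/
def scaleExp (r m : ℕ) : Fin r ⊕ Fin m → ℕ :=
  Sum.elim (fun b => (b : ℕ) + (m - r)) (fun a => a)

theorem two_mul_sum_scaleExp (r m : ℕ) :
    2 * ∑ i, scaleExp r m i = m * (m - 1) + r * (r - 1) + 2 * (m - r) * r := by
  have h1 := Finset.sum_range_id_mul_two m
  have h2 := Finset.sum_range_id_mul_two r
  rw [← Fin.sum_univ_eq_sum_range (fun k => k)] at h1 h2
  rw [Fintype.sum_sum_type]
  simp only [scaleExp, Sum.elim_inl, Sum.elim_inr, Finset.sum_add_distrib, Finset.sum_const,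
    Finset.card_univ, Fintype.card_fin, smul_eq_mul]
  rw [← h1, ← h2]
  ring

/-- This exhibits the order of vanishing of `saddlePencil` at `δ = 0`: the last factor is continuous
in `δ`, and at `δ = 0` both of its matrices are block diagonal with a single nonzero block. -/
theorem saddlePencil_eq_pow_mul {r m : ℕ} (hrm : r ≤ m) {δ : ℝ} (hδ : δ ≠ 0) :
    (-4) ^ (r * m) * saddlePencil (r + m) r δ =
      (δ : ℂ) ^ (m * (m - 1) + r * (r - 1)) *
        pencilCoeff r (scaledUp r m δ) (scaledDown r m δ) := by
  have hδ' : (δ : ℂ) ≠ 0 := by exact_mod_cast hδ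
  have h1 := pencilCoeff_gramMatrix_hermiteBasis (-Complex.I) Complex.I r m r
    (saddleFunctional δ) (conjFunctional (saddleFunctional δ))
  have h2 : gramMatrix (conjFunctional (saddleFunctional δ))
      (fun i : Fin (r + m) => X ^ (i : ℕ)) = (saddleHankel (r + m) δ).map (starRingEnd ℂ) := by
    ext i j
    simp [gramMatrix, saddleHankel, conjFunctional_apply]
  have h3 : (-Complex.I - Complex.I) ^ (2 * (r * m)) = (-4) ^ (r * m) := by
    rw [pow_mul]
    congr 1
    linear_combination 4 * Complex.I_sq
  rw [h2, h3] at h1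
  refine h1.symm.trans ?_
  set w : Fin r ⊕ Fin m → ℂ := fun i => (δ : ℂ) ^ scaleExp r m i
  have hA : gramMatrix (saddleFunctional δ) (hermiteBasis (-Complex.I) Complex.I r m) =
      Matrix.diagonal w * scaledUp r m δ * (Matrix.diagonal w).transpose := by
    ext i j
    rw [Matrix.diagonal_transpose, Matrix.mul_diagonal, Matrix.diagonal_mul, gramMatrix,
      Matrix.of_apply, hermiteBasis_eq, hermiteBasis_eq, mul_mul_mul_comm, ← pow_add, ← pow_add,
      saddleFunctional_pow_mul_pow, scaledUp, Matrix.of_apply, mul_right_comm, ← mul_assoc]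
    congr 1
    simp only [w, ← pow_add]
    congr 1
    rcases i with b | a <;> rcases j with b' | a' <;>
      simp only [scaleExp, ordUp, Sum.elim_inl, Sum.elim_inr] <;> omega
  have hB : (δ : ℂ) ^ (2 * (m - r)) • gramMatrix (conjFunctional (saddleFunctional δ))
      (hermiteBasis (-Complex.I) Complex.I r m) =
      Matrix.diagonal w * scaledDown r m δ * (Matrix.diagonal w).transpose := by
    ext i j
    rw [Matrix.diagonal_transpose, Matrix.mul_diagonal, Matrix.diagonal_mul, Matrix.smul_apply,
      gramMatrix, Matrix.of_apply, hermiteBasis_eq, hermiteBasis_eq, mul_mul_mul_comm, ← pow_add,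
      ← pow_add, conjFunctional_saddleFunctional_pow_mul_pow, scaledDown, Matrix.of_apply,
      mul_right_comm, ← mul_assoc, smul_eq_mul, ← mul_assoc]
    congr 1
    simp only [w, ← pow_add]
    congr 1
    rcases i with b | a <;> rcases j with b' | a' <;>
      simp only [scaleExp, ordDown, Sum.elim_inl, Sum.elim_inr] <;> omega
  have h4 := pencilCoeff_smul_right r ((δ : ℂ) ^ (2 * (m - r)))
    (gramMatrix (saddleFunctional δ) (hermiteBasis (-Complex.I) Complex.I r m))
    (gramMatrix (conjFunctional (saddleFunctional δ)) (hermiteBasis (-Complex.I) Complex.I r m))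
  rw [hB, hA, pencilCoeff_conj_mul, ← hA, Matrix.det_diagonal, Finset.prod_pow_eq_pow_sum,
    ← pow_mul, mul_comm _ 2, two_mul_sum_scaleExp, ← pow_mul, pow_add] at h4
  refine mul_left_cancel₀ (pow_ne_zero (2 * (m - r) * r) hδ') ?_
  rw [← h4]
  ring

theorem continuous_pencilCoeff_scaled (r m : ℕ) :
    Continuous fun δ => pencilCoeff r (scaledUp r m δ) (scaledDown r m δ) := by
  have h1 : Continuous fun δ => scaledUp r m δ :=
    continuous_matrix fun i j =>
      (Complex.continuous_ofReal.pow _).mul (continuous_saddleMoment _ _)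
  have h2 : Continuous fun δ => scaledDown r m δ :=
    continuous_matrix fun i j =>
      (Complex.continuous_ofReal.pow _).mul
        (Complex.continuous_conj.comp (continuous_saddleMoment _ _))
  simp only [pencilCoeff_eq_sum]
  refine continuous_finsetSum _ fun s _ => Continuous.matrix_det ?_
  refine continuous_matrix fun i j => ?_
  by_cases hi : i ∈ s
  · simpa [rowMix, hi] using h2.matrix_elem i j
  · simpa [rowMix, hi] using h1.matrix_elem i j

/-- The Hankel determinant of the Gaussian moments at one saddle point. The powers of `ω` from the
rescaling of `v` and from the Gaussian moments combine to a power of `ω ^ 3 = i`. -/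
theorem det_saddleMoment_zero (m r : ℕ) :
    (Matrix.of fun a a' : Fin m => saddleMoment ((a : ℕ) + a') (r + r) 0).det =
      (-4) ^ (r * m) * (Real.sqrt Real.pi : ℂ) ^ m *
        Complex.exp (Real.pi * Complex.I / 4) ^ (m ^ 2) *
          (2⁻¹ : ℂ) ^ (∑ k ∈ Finset.range m, k) * (barnesG (m + 1) : ℂ) := by
  have hH := det_hankel_of_derivative (cubicGaussFunctional 0)
    (mul_ne_zero two_ne_zero (inv_ne_zero dirSixth_ne_zero)) cubicGaussFunctional_zero_derivative m
  have h1 : (Matrix.of fun a a' : Fin m => saddleMoment ((a : ℕ) + a') (r + r) 0) =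
      Matrix.of fun a a' : Fin m => (dirSixth ^ (a' : ℕ)) *
        (Matrix.of fun a a' : Fin m => (dirSixth ^ (a : ℕ) * ((-4) ^ r * dirSixth)) *
        (Matrix.of fun i j : Fin m => cubicGaussFunctional 0 (X ^ ((i : ℕ) + (j : ℕ)))) a a')
          a a' := by
    ext a a'
    simp only [Matrix.of_apply, saddleMoment]
    have h2 : ((C (2 * Complex.I) + C (dirSixth * ((0 : ℝ) : ℂ)) * X) ^ (r + r) *
        X ^ ((a : ℕ) + a') : ℂ[X]) = ((-4 : ℂ) ^ r) • X ^ ((a : ℕ) + a') := by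
      rw [smul_eq_C_mul, Complex.ofReal_zero, mul_zero, C_0, zero_mul, add_zero, ← C_pow]
      congr 2
      rw [← two_mul, pow_mul]
      congr 1
      linear_combination 4 * Complex.I_sq
    rw [h2, map_smul, smul_eq_mul]
    ring
  rw [h1, Matrix.det_mul_row, Matrix.det_mul_column, hH]
  simp only [Finset.prod_mul_distrib, Finset.prod_const, Finset.card_univ, Fintype.card_fin,
    Finset.prod_pow_eq_pow_sum]
  rw [Fin.sum_univ_eq_sum_range (fun k => k)]
  have hT := Finset.sum_range_id_mul_two m
  set T := ∑ k ∈ Finset.range m, k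
  have h5 : Complex.exp (Real.pi * Complex.I / 4) ^ 2 = Complex.I := by
    rw [← Complex.exp_nat_mul, show ((2 : ℕ) * (Real.pi * Complex.I / 4) : ℂ) =
      Real.pi / 2 * Complex.I by push_cast; ring, Complex.exp_pi_div_two_mul_I]
  have h6 : dirSixth ^ T * dirSixth ^ T * dirSixth ^ T =
      Complex.exp (Real.pi * Complex.I / 4) ^ (m * (m - 1)) := by
    rw [← pow_add, ← pow_add, show T + T + T = 3 * T by ring, pow_mul, dirSixth_pow_three]
    conv_lhs => rw [← h5]
    rw [← pow_mul, ← hT, mul_comm T]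
  have h7 : (dirSixth * cubicGaussFunctional 0 1) ^ m = (Real.sqrt Real.pi : ℂ) ^ m *
      Complex.exp (Real.pi * Complex.I / 4) ^ m := by
    rw [dirSixth_mul_cubicGaussFunctional_one, mul_pow]
  have h8 : Complex.exp (Real.pi * Complex.I / 4) ^ (m ^ 2) =
      Complex.exp (Real.pi * Complex.I / 4) ^ (m * (m - 1)) *
        Complex.exp (Real.pi * Complex.I / 4) ^ m := by
    rw [← pow_add]
    congr 1
    rcases m with _ | m
    · simp
    · simp only [Nat.add_sub_cancel]; ring
  have h9 : (barnesG (m + 1) : ℂ) = ∏ k ∈ Finset.range m, (k.factorial : ℂ) := by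
    simp [barnesG]
  rw [h8, ← h6, h9, mul_inv, inv_inv,
    Finset.prod_pow_eq_pow_sum (Finset.range m) (fun k => k) (2⁻¹ * dirSixth),
    mul_pow _ _ (∑ k ∈ Finset.range m, k), pow_mul (-4 : ℂ)]
  rw [mul_pow] at h7
  linear_combination dirSixth ^ T * dirSixth ^ T * dirSixth ^ T * ((-4) ^ r) ^ m * 2⁻¹ ^ T *
    (∏ k ∈ Finset.range m, (k.factorial : ℂ)) * h7

/-- The leading coefficient of `saddlePencil (r + m) r` at `δ = 0`, for `r ≤ m`. -/
noncomputable def saddleLead (r m : ℕ) : ℂ :=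
  (-4) ^ (r * m) * (Real.sqrt Real.pi : ℂ) ^ (r + m) *
    Complex.exp (Real.pi * Complex.I / 4 * ((m : ℂ) ^ 2 - (r : ℂ) ^ 2)) *
      (2⁻¹ : ℂ) ^ (∑ k ∈ Finset.range m, k + ∑ k ∈ Finset.range r, k) *
        (barnesG (r + 1) : ℂ) * (barnesG (m + 1) : ℂ)

theorem pencilCoeff_scaled_zero (r m : ℕ) :
    pencilCoeff r (scaledUp r m 0) (scaledDown r m 0) = (-4) ^ (r * m) * saddleLead r m := by
  have hA : scaledUp r m 0 = Matrix.fromBlocks 0 0 0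
      (Matrix.of fun a a' : Fin m => saddleMoment ((a : ℕ) + a') (r + r) 0) := by
    ext i j
    rcases i with b | a <;> rcases j with b' | a' <;>
      simp only [scaledUp, ordUp, ordDown, Matrix.of_apply, Sum.elim_inl, Sum.elim_inr,
        Matrix.fromBlocks_apply₁₁, Matrix.fromBlocks_apply₁₂, Matrix.fromBlocks_apply₂₁,
        Matrix.fromBlocks_apply₂₂, Complex.ofReal_zero, Matrix.zero_apply]
    · rw [zero_pow (by have := b.2; omega), zero_mul]
    · rw [zero_pow (by have := b.2; omega), zero_mul]
    · rw [zero_pow (by have := b'.2; omega), zero_mul]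
    · simp
  have hB : scaledDown r m 0 = Matrix.fromBlocks
      ((Matrix.of fun b b' : Fin r => saddleMoment ((b : ℕ) + b') (m + m) 0).map (starRingEnd ℂ))
        0 0 0 := by
    ext i j
    rcases i with b | a <;> rcases j with b' | a' <;>
      simp only [scaledDown, ordUp, ordDown, Matrix.of_apply, Sum.elim_inl, Sum.elim_inr,
        Matrix.fromBlocks_apply₁₁, Matrix.fromBlocks_apply₁₂, Matrix.fromBlocks_apply₂₁,
        Matrix.fromBlocks_apply₂₂, Complex.ofReal_zero, Matrix.zero_apply]
    · simp
    · rw [zero_pow (by have := a'.2; omega), zero_mul]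
    · rw [zero_pow (by have := a.2; omega), zero_mul]
    · rw [zero_pow (by have := a.2; omega), zero_mul]
  have h := pencilCoeff_fromBlocks
    (Matrix.of fun a a' : Fin m => saddleMoment ((a : ℕ) + a') (r + r) 0)
    ((Matrix.of fun b b' : Fin r => saddleMoment ((b : ℕ) + b') (m + m) 0).map (starRingEnd ℂ))
  rw [Fintype.card_fin] at h
  rw [hA, hB, h, ← RingHom.mapMatrix_apply, ← RingHom.map_det, det_saddleMoment_zero,
    det_saddleMoment_zero, saddleLead]
  have he : Complex.exp (Real.pi * Complex.I / 4 * ((m : ℂ) ^ 2 - (r : ℂ) ^ 2)) =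
      Complex.exp (Real.pi * Complex.I / 4) ^ (m ^ 2) *
        (starRingEnd ℂ) (Complex.exp (Real.pi * Complex.I / 4)) ^ (r ^ 2) := by
    rw [← Complex.exp_conj, ← Complex.exp_nat_mul, ← Complex.exp_nat_mul, ← Complex.exp_add]
    congr 1
    simp only [map_div₀, map_mul, Complex.conj_ofReal, Complex.conj_I, map_ofNat]
    push_cast
    ring
  rw [he]
  simp only [map_mul, map_pow, map_neg, map_ofNat, Complex.conj_ofReal, map_inv₀, map_natCast]
  rw [mul_comm m r]
  ring

theorem tendsto_saddlePencil_div {r m : ℕ} (hrm : r ≤ m) :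
    Filter.Tendsto
      (fun δ : ℝ => saddlePencil (r + m) r δ / (δ : ℂ) ^ (m * (m - 1) + r * (r - 1)))
      (nhdsWithin 0 {0}ᶜ) (nhds (saddleLead r m)) := by
  have h4 : ((-4 : ℂ) ^ (r * m)) ≠ 0 := pow_ne_zero _ (by norm_num)
  have h := ((continuous_pencilCoeff_scaled r m).tendsto 0).mono_left
    (nhdsWithin_le_nhds (s := {0}ᶜ))
  rw [pencilCoeff_scaled_zero] at h
  have h2 := h.const_mul ((-4 : ℂ) ^ (r * m))⁻¹
  rw [inv_mul_cancel_left₀ h4] at h2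
  refine h2.congr' ?_
  filter_upwards [self_mem_nhdsWithin] with δ hδ
  have hδ' : (δ : ℂ) ≠ 0 := by exact_mod_cast hδ
  have h5 := saddlePencil_eq_pow_mul hrm hδ
  rw [eq_div_iff (pow_ne_zero _ hδ'), mul_assoc, mul_comm (pencilCoeff _ _ _), ← h5,
    inv_mul_cancel_left₀ h4]

end SaddlePencil

/-! ### Asymptotic expansions from Taylor polynomials -/

section Taylor

open Asymptotics Filter Topology

theorem isLittleO_sub_taylor {f : ℝ → ℂ} (hf : ∀ n : ℕ, ContDiff ℝ n f) (n : ℕ) :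
    (fun δ => f δ - ∑ k ∈ Finset.range (n + 1),
      iteratedDeriv k f 0 / (k.factorial : ℂ) * (δ : ℂ) ^ k) =o[𝓝 0] fun δ : ℝ => δ ^ n := by
  have h := taylor_isLittleO_univ (x₀ := 0) (hf n)
  simp only [taylor_within_apply, iteratedDerivWithin_univ, sub_zero] at h
  refine h.congr_left fun δ => ?_
  congr 1
  refine Finset.sum_congr rfl fun k _ => ?_
  rw [Complex.real_smul]
  push_cast
  ring

theorem iteratedDeriv_zero_of_even {f : ℝ → ℂ} (heven : ∀ δ, f (-δ) = f δ) {k : ℕ} (hk : Odd k) :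
    iteratedDeriv k f 0 = 0 := by
  have h := iteratedDeriv_comp_neg k f 0
  simp only [heven, neg_zero, hk.neg_one_pow, neg_smul, one_smul] at h
  exact self_eq_neg.1 h

theorem sum_range_two_mul (g : ℕ → ℂ) (t : ℕ) :
    ∑ k ∈ Finset.range (2 * t), g k =
      ∑ p ∈ Finset.range t, g (2 * p) + ∑ p ∈ Finset.range t, g (2 * p + 1) := by
  induction t with
  | zero => simp
  | succ t ih =>
    rw [show 2 * (t + 1) = 2 * t + 1 + 1 by ring, Finset.sum_range_succ, Finset.sum_range_succ, ih,
      Finset.sum_range_succ, Finset.sum_range_succ]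
    ring

/-- An even smooth function that behaves like `ℓ δ ^ (2 μ)` at `0` has an expansion in
`δ ^ (2 μ + 2 j)` with leading coefficient `ℓ`. -/
theorem exists_even_expansion {f : ℝ → ℂ} (hf : ∀ n : ℕ, ContDiff ℝ n f)
    (heven : ∀ δ, f (-δ) = f δ) {μ : ℕ} {ℓ : ℂ}
    (hlim : Tendsto (fun δ : ℝ => f δ / (δ : ℂ) ^ (2 * μ)) (𝓝[≠] 0) (𝓝 ℓ)) :
    ∃ a : ℕ → ℂ, a 0 = ℓ ∧ ∀ N : ℕ,
      (fun δ : ℝ => f δ - ∑ j ∈ Finset.range N, a j * (δ : ℂ) ^ (2 * μ + 2 * j)) =O[𝓝 0]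
        fun δ : ℝ => δ ^ (2 * μ + 2 * N) := by
  set t : ℕ → ℂ := fun k => iteratedDeriv k f 0 / (k.factorial : ℂ)
  have hcoe : Tendsto (fun δ : ℝ => (δ : ℂ)) (𝓝[≠] 0) (𝓝 0) := by
    have := (Complex.continuous_ofReal.tendsto 0).mono_left (nhdsWithin_le_nhds (s := {0}ᶜ))
    simpa using this
  have hne : ∀ᶠ δ : ℝ in 𝓝[≠] 0, (δ : ℂ) ≠ 0 := by
    filter_upwards [self_mem_nhdsWithin] with δ hδ
    exact_mod_cast hδ
  -- the Taylor coefficients below the order `2 μ` vanish, and the next one is `ℓ`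
  have ht : ∀ k, k ≤ 2 * μ → t k = ℓ * 0 ^ (2 * μ - k) := by
    intro k
    induction k using Nat.strong_induction_on with
    | _ k ih =>
      intro hk
      have h1 := (isLittleO_sub_taylor hf k).mono (nhdsWithin_le_nhds (s := {0}ᶜ))
      have h2 : Tendsto (fun δ : ℝ => f δ / (δ : ℂ) ^ k - t k) (𝓝[≠] 0) (𝓝 0) := by
        have h3 := (isLittleO_norm_norm.2 h1).tendsto_div_nhds_zero
        rw [tendsto_zero_iff_norm_tendsto_zero]
        refine h3.congr' ?_
        filter_upwards [hne] with δ hδ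
        rw [Finset.sum_range_succ, Finset.sum_eq_zero, zero_add]
        · have h4 : f δ / (δ : ℂ) ^ k - t k = (f δ - t k * (δ : ℂ) ^ k) / (δ : ℂ) ^ k := by
            field_simp
          rw [h4, norm_div]
          simp [t]
        · intro j hj
          have hj' := Finset.mem_range.1 hj
          change t j * _ = 0
          rw [ih j hj' (by omega), zero_pow (by omega)]
          simp
      have h5 : Tendsto (fun δ : ℝ => f δ / (δ : ℂ) ^ k) (𝓝[≠] 0) (𝓝 (t k)) := by
        simpa using h2.add_const (t k)
      have h6 : Tendsto (fun δ : ℝ => f δ / (δ : ℂ) ^ k) (𝓝[≠] 0) (𝓝 (ℓ * 0 ^ (2 * μ - k))) := by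
        refine (hlim.mul (hcoe.pow (2 * μ - k))).congr' ?_
        filter_upwards [hne] with δ hδ
        rw [div_mul_eq_mul_div, div_eq_div_iff (pow_ne_zero _ hδ) (pow_ne_zero _ hδ), mul_assoc,
          ← pow_add, Nat.sub_add_cancel hk]
      exact tendsto_nhds_unique h5 h6
  have hodd : ∀ k, Odd k → t k = 0 := by
    intro k hk
    simp only [t, iteratedDeriv_zero_of_even heven hk, zero_div]
  refine ⟨fun j => t (2 * μ + 2 * j), by simpa using ht (2 * μ) le_rfl, fun N => ?_⟩
  have h1 := (isLittleO_sub_taylor hf (2 * μ + 2 * N)).isBigO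
  have h2 : ∀ δ : ℝ, ∑ k ∈ Finset.range (2 * μ + 2 * N), t k * (δ : ℂ) ^ k =
      ∑ j ∈ Finset.range N, t (2 * μ + 2 * j) * (δ : ℂ) ^ (2 * μ + 2 * j) := by
    intro δ
    rw [← mul_add, sum_range_two_mul, Finset.sum_eq_zero (s := Finset.range (μ + N))
      (f := fun p => t (2 * p + 1) * (δ : ℂ) ^ (2 * p + 1)), add_zero, Finset.sum_range_add,
      Finset.sum_eq_zero (s := Finset.range μ), zero_add]
    · simp only [mul_add]
    · intro p hp
      have hp' := Finset.mem_range.1 hp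
      rw [ht _ (by omega), zero_pow (by omega)]
      simp
    · intro p _
      rw [hodd _ (odd_two_mul_add_one p), zero_mul]
  have h3 : (fun δ : ℝ => t (2 * μ + 2 * N) * (δ : ℂ) ^ (2 * μ + 2 * N)) =O[𝓝 0]
      fun δ : ℝ => δ ^ (2 * μ + 2 * N) := by
    refine IsBigO.of_bound ‖t (2 * μ + 2 * N)‖ (Eventually.of_forall fun δ => ?_)
    simp
  refine (h1.add h3).congr_left fun δ => ?_
  rw [Finset.sum_range_succ, ← h2]
  ring

theorem HasOscExpansion.const_mul {f : ℝ → ℂ} {M e : ℝ} {c : ℕ → ℂ} (h : HasOscExpansion f M e c)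
    (k : ℂ) : HasOscExpansion (fun z => k * f z) M e (fun j => k * c j) := by
  intro N
  refine ((h N).const_mul_left k).congr_left fun z => ?_
  simp only [mul_assoc k, ← Finset.mul_sum]
  ring

theorem HasOscExpansion.add {f g : ℝ → ℂ} {M e : ℝ} {c d : ℕ → ℂ} (hf : HasOscExpansion f M e c)
    (hg : HasOscExpansion g M e d) :
    HasOscExpansion (fun z => f z + g z) M e (fun j => c j + d j) := by
  intro N
  refine ((hf N).add (hg N)).congr_left fun z => ?_
  simp only [add_mul, Finset.sum_add_distrib]
  ring

theorem HasOscExpansion.conj {f : ℝ → ℂ} {M e : ℝ} {c : ℕ → ℂ} (h : HasOscExpansion f M e c) :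
    HasOscExpansion (fun z => (starRingEnd ℂ) (f z)) M e (fun j => (starRingEnd ℂ) (c j)) := by
  intro N
  refine IsBigO.of_norm_left ((h N).norm_left.congr_left fun z => ?_)
  rw [← Complex.norm_conj]
  simp only [map_sub, map_mul, map_sum, Complex.conj_ofReal]

end Taylor

/-! ### The amplitudes -/

section Amplitude

open Asymptotics Filter Topology

/-- The small parameter `δ = 2 ^ (1 / 4) z ^ (-3 / 4)`. -/
noncomputable def smallParam (z : ℝ) : ℝ := 2 ^ (1 / 4 : ℝ) * z ^ (-(3 / 4) : ℝ)

/-- The amplitude of the exponential `exp (i ψ_{n,r})` in the tau function, for `n = r + m`, without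
the dependence on the constants `C₁`, `C₂`. It is written as its leading term
`M_{n,r} z ^ (3 r (n - r) / 2)` times a function of `δ` that tends to `1`; `tauTerm_eq` shows that
this normalization is the right one. -/
noncomputable def oscAmp (r m : ℕ) (z : ℝ) : ℂ :=
  (oscConst (r + m) r : ℂ) *
    ((z ^ (3 / 2 * (r : ℝ) * (((r + m : ℕ) : ℝ) - (r : ℝ))) : ℝ) : ℂ) *
      ((saddleLead r m)⁻¹ * (saddlePencil (r + m) r (smallParam z) /
        (smallParam z : ℂ) ^ (m * (m - 1) + r * (r - 1))))

theorem barnesG_ne_zero (n : ℕ) : (barnesG n : ℂ) ≠ 0 := by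
  rw [barnesG]
  exact_mod_cast Finset.prod_ne_zero_iff.2 fun k _ => Nat.factorial_ne_zero k

theorem saddleLead_ne_zero (r m : ℕ) : saddleLead r m ≠ 0 := by
  have h1 : ((Real.sqrt Real.pi : ℝ) : ℂ) ≠ 0 := by
    exact_mod_cast (Real.sqrt_pos.2 Real.pi_pos).ne'
  have h2 := barnesG_ne_zero (r + 1)
  have h3 := barnesG_ne_zero (m + 1)
  rw [saddleLead]
  exact mul_ne_zero (mul_ne_zero (mul_ne_zero (mul_ne_zero (mul_ne_zero
    (pow_ne_zero _ (by norm_num)) (pow_ne_zero _ h1)) (Complex.exp_ne_zero _))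
    (pow_ne_zero _ (by norm_num))) h2) h3

theorem tendsto_smallParam : Tendsto smallParam atTop (𝓝 0) := by
  have h := (tendsto_rpow_neg_atTop (show (0 : ℝ) < 3 / 4 by norm_num)).const_mul
    ((2 : ℝ) ^ (1 / 4 : ℝ))
  rw [mul_zero] at h
  exact h

theorem smallParam_pos {z : ℝ} (hz : 0 < z) : 0 < smallParam z := by
  unfold smallParam
  positivity

theorem smallParam_pow_two_mul {z : ℝ} (hz : 0 < z) (j : ℕ) :
    smallParam z ^ (2 * j) = 2 ^ ((j : ℝ) / 2) * z ^ (-(3 * (j : ℝ) / 2)) := by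
  rw [smallParam, mul_pow, ← Real.rpow_natCast, ← Real.rpow_natCast, ← Real.rpow_mul two_pos.le,
    ← Real.rpow_mul hz.le]
  congr 2 <;> (push_cast; ring)

theorem exists_hasOscExpansion_oscAmp {r m : ℕ} (hrm : r ≤ m) :
    ∃ c : ℕ → ℂ, c 0 = 1 ∧ HasOscExpansion (oscAmp r m) (oscConst (r + m) r)
      (3 / 2 * (r : ℝ) * (((r + m : ℕ) : ℝ) - (r : ℝ))) c := by
  obtain ⟨μ, hμ⟩ : ∃ μ, m * (m - 1) + r * (r - 1) = 2 * μ :=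
    ⟨∑ k ∈ Finset.range m, k + ∑ k ∈ Finset.range r, k, by
      rw [mul_add, mul_comm 2, mul_comm 2, Finset.sum_range_id_mul_two,
        Finset.sum_range_id_mul_two]⟩
  have hlim := tendsto_saddlePencil_div hrm
  rw [hμ] at hlim
  obtain ⟨a, ha0, ha⟩ := exists_even_expansion (fun n => contDiff_saddlePencil n (r + m) r)
    (saddlePencil_neg (r + m) r) hlim
  have hℓ := saddleLead_ne_zero r m
  set e : ℝ := 3 / 2 * (r : ℝ) * (((r + m : ℕ) : ℝ) - (r : ℝ))
  refine ⟨fun j => (saddleLead r m)⁻¹ * (a j * ((2 ^ ((j : ℝ) / 2) : ℝ) : ℂ)), ?_, fun N => ?_⟩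
  · simp [ha0, hℓ]
  have h1 := (ha N).comp_tendsto tendsto_smallParam
  have h2 := (h1.norm_norm).mul
    (isBigO_refl (fun z : ℝ => z ^ e / smallParam z ^ (2 * μ)) atTop)
  have h3 : (fun z : ℝ => z ^ e * smallParam z ^ (2 * N)) =O[atTop]
      fun z : ℝ => z ^ (e - 3 * (N : ℝ) / 2) := by
    refine IsBigO.of_bound (2 ^ ((N : ℝ) / 2)) ?_
    filter_upwards [eventually_gt_atTop 0] with z hz
    rw [smallParam_pow_two_mul hz, sub_eq_add_neg, Real.rpow_add hz,
      Real.norm_of_nonneg (by positivity), Real.norm_of_nonneg (by positivity)]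
    exact le_of_eq (by ring)
  have h4 : (fun z : ℝ => ‖saddlePencil (r + m) r (smallParam z) -
      ∑ j ∈ Finset.range N, a j * (smallParam z : ℂ) ^ (2 * μ + 2 * j)‖ *
        (z ^ e / smallParam z ^ (2 * μ))) =O[atTop] fun z : ℝ => z ^ (e - 3 * (N : ℝ) / 2) := by
    refine h2.trans (IsBigO.trans (EventuallyEq.isBigO ?_) h3)
    filter_upwards [eventually_gt_atTop 0] with z hz
    have hp := smallParam_pos hz
    simp only [Function.comp_apply]
    rw [Real.norm_of_nonneg (by positivity), pow_add]
    field_simp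
  refine IsBigO.trans ?_ h4
  refine IsBigO.of_bound (‖(oscConst (r + m) r : ℂ)‖ * ‖(saddleLead r m)⁻¹‖) ?_
  filter_upwards [eventually_gt_atTop 0] with z hz
  have hp := smallParam_pos hz
  have hp' : (smallParam z : ℂ) ≠ 0 := by exact_mod_cast hp.ne'
  have h5 : ∑ j ∈ Finset.range N, (saddleLead r m)⁻¹ * (a j * ((2 ^ ((j : ℝ) / 2) : ℝ) : ℂ)) *
      ((z ^ (-(3 * (j : ℝ) / 2)) : ℝ) : ℂ) = (saddleLead r m)⁻¹ *
        ((∑ j ∈ Finset.range N, a j * (smallParam z : ℂ) ^ (2 * μ + 2 * j)) /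
          (smallParam z : ℂ) ^ (2 * μ)) := by
    rw [Finset.sum_div, Finset.mul_sum]
    refine Finset.sum_congr rfl fun j _ => ?_
    rw [pow_add, ← Complex.ofReal_pow (smallParam z) (2 * j), smallParam_pow_two_mul hz]
    push_cast
    field_simp
  rw [h5, oscAmp, hμ, ← mul_sub, ← mul_sub, ← sub_div, norm_mul, norm_mul, norm_mul, norm_div,
    norm_pow, Complex.norm_real (z ^ _), Complex.norm_real (smallParam z),
    Real.norm_of_nonneg (Real.rpow_nonneg hz.le _), Real.norm_of_nonneg hp.le, norm_mul, norm_norm,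
    Real.norm_of_nonneg (by positivity)]
  exact le_of_eq (by ring)

/-- The numerical constants and the powers of `z` in front of each term of the tau function. -/
theorem prefactor_eq (r m : ℕ) {z : ℝ} (hz : 0 < z) {κ : ℝ}
    (hκ : κ = ((2 : ℝ) ^ (-(1 / 3) : ℝ) * z) ^ (1 / 4 : ℝ)) :
    ((2 : ℝ) ^ (-(1 / 3) : ℝ) * κ ^ 2) ^ ((r + m) * (r + m - 1)) * (2 * Real.pi * κ)⁻¹ ^ (r + m) =
      tauConst (r + m) * z ^ (-(((r + m : ℕ) : ℝ) ^ 2 / 4)) *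
        ((2 : ℝ) ^ (5 / 2 * (r : ℝ) * (((r + m : ℕ) : ℝ) - (r : ℝ))) *
          z ^ (3 / 2 * (r : ℝ) * (((r + m : ℕ) : ℝ) - (r : ℝ)))) *
        (4 ^ (r * m) * Real.sqrt Real.pi ^ (r + m) *
          2⁻¹ ^ (∑ k ∈ Finset.range m, k + ∑ k ∈ Finset.range r, k))⁻¹ *
        (smallParam z ^ (m * (m - 1) + r * (r - 1)))⁻¹ := by
  have hcast : ∀ k : ℕ, ((k * (k - 1) : ℕ) : ℝ) = (k : ℝ) ^ 2 - k := by
    intro k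
    rcases k with _ | k
    · simp
    · push_cast [Nat.add_sub_cancel]; ring
  have hsum : ∀ k : ℕ, ((∑ i ∈ Finset.range k, i : ℕ) : ℝ) = ((k : ℝ) ^ 2 - k) / 2 := by
    intro k
    rw [← hcast, ← Finset.sum_range_id_mul_two]
    push_cast
    ring
  have h4 : (4 : ℝ) ^ (r * m) = Real.exp (((r * m : ℕ) : ℝ) * (2 * Real.log 2)) := by
    rw [Real.exp_nat_mul, mul_comm 2, Real.exp_mul, Real.exp_log two_pos]; norm_num
  -- every factor is the exponential of a linear form in `log 2`, `log π`, `log z`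
  have hpow2 : ∀ x : ℝ, (2 : ℝ) ^ x = Real.exp (Real.log 2 * x) :=
    fun x => Real.rpow_def_of_pos two_pos x
  have hpowpi : ∀ x : ℝ, Real.pi ^ x = Real.exp (Real.log Real.pi * x) :=
    fun x => Real.rpow_def_of_pos Real.pi_pos x
  have hpowz : ∀ x : ℝ, z ^ x = Real.exp (Real.log z * x) := fun x => Real.rpow_def_of_pos hz x
  have hκ' : κ = Real.exp ((-(1 / 3) * Real.log 2 + Real.log z) * (1 / 4)) := by
    rw [hκ, Real.rpow_def_of_pos (by positivity), Real.log_mul (by positivity) hz.ne',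
      Real.log_rpow two_pos]
  have hinv : (2 : ℝ)⁻¹ = Real.exp (-Real.log 2) := by rw [Real.exp_neg, Real.exp_log two_pos]
  have hlead : (2 * Real.pi * κ)⁻¹ = Real.exp (-(Real.log 2 + Real.log Real.pi +
      (-(1 / 3) * Real.log 2 + Real.log z) * (1 / 4))) := by
    rw [Real.exp_neg, Real.exp_add, Real.exp_add, ← hκ', Real.exp_log two_pos,
      Real.exp_log Real.pi_pos]
  have hsp : smallParam z = Real.exp (Real.log 2 * (1 / 4) + Real.log z * -(3 / 4)) := by
    rw [smallParam, hpow2, hpowz, Real.exp_add]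
  rw [hlead, hsp, tauConst, Real.sqrt_eq_rpow, hinv, h4, hκ']
  simp only [hpow2, hpowpi, hpowz, ← Real.exp_nat_mul, ← Real.exp_add, ← Real.exp_neg,
    ← Real.exp_sub]
  congr 1
  have e1 := hcast (r + m)
  have e2 := hcast m
  have e3 := hcast r
  have e4 := hsum m
  have e5 := hsum r
  rw [Nat.cast_add (m * (m - 1)), Nat.cast_add (∑ k ∈ Finset.range m, k), e1, e2, e3, e4, e5]
  push_cast
  ring

end Amplitude

/-! ### The leading coefficients -/

theorem add_pow_mul_sub_pow (C₂ y : ℂ) (r m : ℕ) :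
    (C₂ + y) ^ r * (C₂ - y) ^ m =
      ∑ k ∈ Finset.range (r + m + 1), (oscBinom (r + m) r k : ℂ) * y ^ k * C₂ ^ (r + m - k) := by
  rw [add_comm C₂, sub_eq_neg_add, add_pow, add_pow, Finset.sum_mul_sum, Finset.sum_sigma']
  simp only [oscBinom, Int.cast_sum, Finset.sum_mul]
  rw [Finset.sum_sigma']
  refine Finset.sum_bij' (fun x _ => ⟨x.1 + x.2, x.2⟩) (fun x _ => ⟨x.1 - x.2, x.2⟩) ?_ ?_ ?_ ?_ ?_
  · rintro ⟨a, q⟩ h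
    simp only [Finset.mem_sigma, Finset.mem_range, Finset.mem_Icc] at h ⊢
    omega
  · rintro ⟨k, q⟩ h
    simp only [Finset.mem_sigma, Finset.mem_range, Finset.mem_Icc] at h ⊢
    omega
  · rintro ⟨a, q⟩ h
    simp
  · rintro ⟨k, q⟩ h
    simp only [Finset.mem_sigma, Finset.mem_range, Finset.mem_Icc] at h
    simp only [Sigma.mk.injEq, heq_eq_eq, and_true]
    omega
  · rintro ⟨a, q⟩ h
    simp only [Finset.mem_sigma, Finset.mem_range] at h
    simp only [Nat.add_sub_cancel, Nat.add_sub_cancel_left]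
    have h1 : C₂ ^ (r + m - (a + q)) = C₂ ^ (r - a) * C₂ ^ (m - q) := by
      rw [← pow_add]; congr 1; omega
    rw [h1, neg_pow]
    push_cast
    ring

theorem sum_range_succ_even_odd (g : ℕ → ℂ) (n : ℕ) :
    ∑ k ∈ Finset.range (n + 1), g k = ∑ p ∈ Finset.range (n / 2 + 1), g (2 * p) +
      ∑ p ∈ Finset.range ((n + 1) / 2), g (2 * p + 1) := by
  rcases Nat.even_or_odd' n with ⟨t, rfl | rfl⟩
  · rw [show 2 * t / 2 = t by omega, show (2 * t + 1) / 2 = t by omega, Finset.sum_range_succ,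
      sum_range_two_mul, Finset.sum_range_succ]
    ring
  · rw [show (2 * t + 1) / 2 = t by omega, show (2 * t + 1 + 1) / 2 = t + 1 by omega,
      show 2 * t + 1 + 1 = 2 * (t + 1) by ring, sum_range_two_mul]

/-- For `ε = ± i` these are the constants in front of `exp (± i ψ_{n,r})`. -/
theorem add_pow_mul_sub_pow_of_sq (C₁ C₂ : ℂ) {ε : ℂ} (hε : ε ^ 2 = -1) (r m : ℕ) :
    (C₂ + ε * C₁) ^ r * (C₂ - ε * C₁) ^ m =
      oscB0 C₁ C₂ (r + m) r - ε * oscD0 C₁ C₂ (r + m) r := by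
  rw [add_pow_mul_sub_pow, sum_range_succ_even_odd, oscB0, oscD0, sub_eq_add_neg, Finset.mul_sum,
    ← Finset.sum_neg_distrib]
  congr 1
  · refine Finset.sum_congr rfl fun p _ => ?_
    rw [mul_pow, pow_mul ε, hε]
    ring
  · refine Finset.sum_congr rfl fun p _ => ?_
    rw [mul_pow, pow_succ ε, pow_mul ε, hε]
    ring

/-! ### The tau function as a sum over the pencil -/

section Tau

/-- The term of the tau function in which `r` rows of the Hankel determinant come from the saddle
point `-i`. -/
noncomputable def tauTerm (C₁ C₂ : ℂ) (n r : ℕ) (z : ℝ) : ℂ :=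
  let κ : ℝ := ((2 : ℝ) ^ (-(1 / 3) : ℝ) * z) ^ (1 / 4 : ℝ)
  (((((2 : ℝ) ^ (-(1 / 3) : ℝ) * κ ^ 2) ^ (n * (n - 1)) * (2 * Real.pi * κ)⁻¹ ^ n : ℝ)) : ℂ) *
    (((C₂ - Complex.I * C₁) * Complex.exp (2 * Complex.I * κ ^ 6 / 3)) ^ (n - r) *
      ((C₂ + Complex.I * C₁) * Complex.exp (-(2 * Complex.I * κ ^ 6 / 3))) ^ r *
        saddlePencil n r (smallParam z))

/-- With `x = 2 ^ (-1 / 3) z = κ ^ 4`, a power of `2 ^ (-1 / 3) κ ^ 2` comes out of each row and each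
column of the Hankel matrix of the seed function, and a pencil of saddle point matrices is left. -/
theorem airyTau_eq_sum_tauTerm (C₁ C₂ : ℂ) (n : ℕ) {z : ℝ} (hz : 0 < z) :
    airyTau C₁ C₂ n z = ∑ r ∈ Finset.range (n + 1), tauTerm C₁ C₂ n r z := by
  have hc : (0 : ℝ) < (2 : ℝ) ^ (-(1 / 3) : ℝ) := by positivity
  obtain ⟨κ, hκ⟩ : ∃ κ : ℝ, κ = ((2 : ℝ) ^ (-(1 / 3) : ℝ) * z) ^ (1 / 4 : ℝ) := ⟨_, rfl⟩
  have hκ0 : 0 < κ := by rw [hκ]; positivity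
  have hκc : (κ : ℂ) ≠ 0 := by exact_mod_cast hκ0.ne'
  have hκ4 : (2 : ℝ) ^ (-(1 / 3) : ℝ) * z = κ ^ 4 := by
    rw [hκ, ← Real.rpow_natCast, ← Real.rpow_mul (by positivity)]
    norm_num
  have hδ : κ⁻¹ ^ 3 = smallParam z := by
    rw [hκ, smallParam, ← Real.rpow_neg (by positivity), ← Real.rpow_natCast,
      ← Real.rpow_mul (by positivity), Real.mul_rpow (by positivity) hz.le,
      ← Real.rpow_mul two_pos.le]
    norm_num
  simp only [tauTerm, ← hκ]
  set c : ℝ := (2 : ℝ) ^ (-(1 / 3) : ℝ)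
  set α : ℂ := (C₂ - Complex.I * C₁) * Complex.exp (2 * Complex.I * κ ^ 6 / 3)
  set β : ℂ := (C₂ + Complex.I * C₁) * Complex.exp (-(2 * Complex.I * κ ^ 6 / 3))
  set H := saddleHankel n (smallParam z)
  have hpen := det_smul_add_smul α β H (H.map (starRingEnd ℂ))
  rw [Fintype.card_fin] at hpen
  rw [← Finset.mul_sum]
  simp only [saddlePencil]
  rw [← hpen, airyTau]
  have hentry : (Matrix.of fun j k : Fin n =>
      iteratedDeriv ((j : ℕ) + (k : ℕ)) (airySeed C₁ C₂) (z : ℂ)) =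
      Matrix.of fun j k : Fin n => ((c * κ ^ 2 : ℝ) : ℂ) ^ (k : ℕ) *
        (Matrix.of fun j k : Fin n => (((c * κ ^ 2 : ℝ) : ℂ) ^ (j : ℕ) *
          ((2 * Real.pi * κ)⁻¹ : ℝ)) * (α • H + β • H.map (starRingEnd ℂ)) j k) j k := by
    ext j k
    have he : (starRingEnd ℂ) (Complex.exp (2 * Complex.I * κ ^ 6 / 3)) =
        Complex.exp (-(2 * Complex.I * κ ^ 6 / 3)) := by
      rw [← Complex.exp_conj]
      congr 1
      simp only [map_div₀, map_mul, map_pow, Complex.conj_ofReal, Complex.conj_I, map_ofNat]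
      ring
    simp only [Matrix.of_apply, Matrix.add_apply, Matrix.smul_apply, Matrix.map_apply, smul_eq_mul]
    rw [iteratedDeriv_airySeed_ofReal, show (2 : ℝ) ^ (-(1 / 3) : ℝ) = c from rfl, hκ4,
      upperMoment_eq hκ0, hδ]
    simp only [map_mul, map_inv₀, map_pow, Complex.conj_ofReal, he, H, saddleHankel, gramMatrix,
      Matrix.of_apply, ← pow_add]
    simp only [α, β]
    push_cast
    ring
  rw [hentry, Matrix.det_mul_row, Matrix.det_mul_column]
  simp only [Finset.prod_mul_distrib, Finset.prod_const, Finset.card_univ, Fintype.card_fin]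
  rw [Fin.prod_univ_eq_prod_range (fun k => ((c * κ ^ 2 : ℝ) : ℂ) ^ k),
    Finset.prod_pow_eq_pow_sum (Finset.range n) (fun k => k), ← mul_assoc, ← mul_assoc, ← pow_add,
    ← mul_two, Finset.sum_range_id_mul_two]
  push_cast
  ring

end Tau

/-! ### Trigonometric form of the tau function -/

section Trig

theorem oscConst_mul_inv_saddleLead (r m : ℕ) :
    (oscConst (r + m) r : ℂ) * (saddleLead r m)⁻¹ =
      ((2 ^ (5 / 2 * (r : ℝ) * (((r + m : ℕ) : ℝ) - (r : ℝ))) *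
        (4 ^ (r * m) * Real.sqrt Real.pi ^ (r + m) *
          2⁻¹ ^ (∑ k ∈ Finset.range m, k + ∑ k ∈ Finset.range r, k))⁻¹ : ℝ) : ℂ) *
      (Complex.exp (Real.pi * Complex.I / 4 * ((m : ℂ) ^ 2 - (r : ℂ) ^ 2)))⁻¹ := by
  have h2 := barnesG_ne_zero (r + 1)
  have h3 := barnesG_ne_zero (m + 1)
  have h4 : ((-1 : ℂ) ^ (r * m)) * (-1) ^ (r * m) = 1 := by
    rw [← mul_pow]; simp
  rw [oscConst, saddleLead, Nat.add_sub_cancel_left, neg_pow (4 : ℂ), ← div_eq_mul_inv,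
    div_eq_iff]
  · have h1 : ((Real.sqrt Real.pi : ℝ) : ℂ) ≠ 0 := by
      exact_mod_cast (Real.sqrt_pos.2 Real.pi_pos).ne'
    have h5 := Complex.exp_ne_zero (Real.pi * Complex.I / 4 * ((m : ℂ) ^ 2 - (r : ℂ) ^ 2))
    push_cast
    field_simp
  · have := saddleLead_ne_zero r m
    rwa [saddleLead, neg_pow] at this

theorem tauTerm_eq (C₁ C₂ : ℂ) (r m : ℕ) {z : ℝ} (hz : 0 < z) :
    tauTerm C₁ C₂ (r + m) r z =
      (tauConst (r + m) : ℂ) * ((z ^ (-(((r + m : ℕ) : ℝ) ^ 2 / 4)) : ℝ) : ℂ) *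
        ((C₂ - Complex.I * C₁) ^ m * (C₂ + Complex.I * C₁) ^ r) *
          Complex.exp (oscPhase (r + m) r z * Complex.I) * oscAmp r m z := by
  obtain ⟨κ, hκ⟩ : ∃ κ : ℝ, κ = ((2 : ℝ) ^ (-(1 / 3) : ℝ) * z) ^ (1 / 4 : ℝ) := ⟨_, rfl⟩
  have hexp : Complex.exp (oscPhase (r + m) r z * Complex.I) =
      Complex.exp (2 * Complex.I * κ ^ 6 / 3) ^ m * Complex.exp (-(2 * Complex.I * κ ^ 6 / 3)) ^ r *
        Complex.exp (Real.pi * Complex.I / 4 * ((m : ℂ) ^ 2 - (r : ℂ) ^ 2)) := by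
    have h6 : κ ^ 6 = Real.sqrt 2 / 2 * z ^ (3 / 2 : ℝ) := by
      have h7 : ((2 : ℝ) ^ (-(1 / 3) : ℝ)) ^ (3 / 2 : ℝ) = Real.sqrt 2 / 2 := by
        rw [← Real.rpow_mul two_pos.le, show (-(1 / 3) * (3 / 2) : ℝ) = 1 / 2 - 1 by norm_num,
          Real.rpow_sub two_pos, Real.rpow_one, Real.sqrt_eq_rpow]
      rw [hκ, ← Real.rpow_natCast, ← Real.rpow_mul (by positivity),
        show (1 / 4 * ((6 : ℕ) : ℝ)) = 3 / 2 by norm_num, Real.mul_rpow (by positivity) hz.le, h7]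
    have h6c : (κ : ℂ) ^ 6 = Real.sqrt 2 / 2 * ((z ^ (3 / 2 : ℝ) : ℝ) : ℂ) := by
      rw [← Complex.ofReal_pow, h6]
      push_cast
      ring
    rw [← Complex.exp_nat_mul, ← Complex.exp_nat_mul, ← Complex.exp_add, ← Complex.exp_add, h6c,
      oscPhase]
    congr 1
    push_cast
    ring
  have hpre := congrArg (fun x : ℝ => (x : ℂ)) (prefactor_eq r m hz hκ)
  have hlead := oscConst_mul_inv_saddleLead r m
  have h5 := Complex.exp_ne_zero (Real.pi * Complex.I / 4 * ((m : ℂ) ^ 2 - (r : ℂ) ^ 2))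
  simp only [tauTerm, ← hκ]
  rw [hpre, oscAmp, hexp, Nat.add_sub_cancel_left, mul_pow _ (Complex.exp _),
    mul_pow _ (Complex.exp _)]
  set E : ℂ := Complex.exp (Real.pi * Complex.I / 4 * ((m : ℂ) ^ 2 - (r : ℂ) ^ 2))
  set R : ℝ := 2 ^ (5 / 2 * (r : ℝ) * (((r + m : ℕ) : ℝ) - (r : ℝ)))
  set S : ℝ := 4 ^ (r * m) * Real.sqrt Real.pi ^ (r + m) *
    2⁻¹ ^ (∑ k ∈ Finset.range m, k + ∑ k ∈ Finset.range r, k)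
  have hlead' : (oscConst (r + m) r : ℂ) * (saddleLead r m)⁻¹ * E = ((R * S⁻¹ : ℝ) : ℂ) := by
    rw [hlead, mul_assoc, inv_mul_cancel₀ h5, mul_one]
  rw [Complex.ofReal_mul, Complex.ofReal_inv] at hlead'
  simp only [Complex.ofReal_mul, Complex.ofReal_inv, Complex.ofReal_pow]
  linear_combination (-(tauConst (r + m) : ℂ) * ((z ^ (-(((r + m : ℕ) : ℝ) ^ 2 / 4)) : ℝ) : ℂ) *
    ((z ^ (3 / 2 * (r : ℝ) * (((r + m : ℕ) : ℝ) - (r : ℝ))) : ℝ) : ℂ) *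
    ((C₂ - Complex.I * C₁) ^ m * (C₂ + Complex.I * C₁) ^ r) *
    (Complex.exp (2 * Complex.I * κ ^ 6 / 3) ^ m * Complex.exp (-(2 * Complex.I * κ ^ 6 / 3)) ^ r) *
    (saddlePencil (r + m) r (smallParam z) /
      (smallParam z : ℂ) ^ (m * (m - 1) + r * (r - 1)))) * hlead'

/-- Conjugation exchanges the two saddle points. -/
theorem tauTerm_swap (C₁ C₂ : ℂ) (r m : ℕ) (z : ℝ) :
    tauTerm C₁ C₂ (r + m) m z = (starRingEnd ℂ)
      (tauTerm ((starRingEnd ℂ) C₁) ((starRingEnd ℂ) C₂) (r + m) r z) := by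
  have h := saddlePencil_sub (r + m) r (Nat.le_add_right r m) (smallParam z)
  rw [Nat.add_sub_cancel_left] at h
  simp only [tauTerm, map_mul, map_pow, map_sub, map_add, map_neg, map_div₀, Complex.conj_ofReal,
    Complex.conj_conj, Complex.conj_I, map_ofNat, ← Complex.exp_conj, h, Nat.add_sub_cancel_left,
    Nat.add_sub_cancel]
  rw [show (2 * -Complex.I * (((2 : ℝ) ^ (-(1 / 3) : ℝ) * z) ^ (1 / 4 : ℝ) : ℝ) ^ 6 / 3 : ℂ) =
    -(2 * Complex.I * (((2 : ℝ) ^ (-(1 / 3) : ℝ) * z) ^ (1 / 4 : ℝ) : ℝ) ^ 6 / 3) by ring]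
  ring_nf

/-- The coefficient of the cosine. -/
noncomputable def cosAmp (C₁ C₂ : ℂ) (n r : ℕ) (z : ℝ) : ℂ :=
  1 / 2 * ((C₂ - Complex.I * C₁) ^ (n - r) * (C₂ + Complex.I * C₁) ^ r) * oscAmp r (n - r) z +
    1 / 2 * ((C₂ + Complex.I * C₁) ^ (n - r) * (C₂ - Complex.I * C₁) ^ r) *
      (starRingEnd ℂ) (oscAmp r (n - r) z)

/-- The coefficient of the sine. -/
noncomputable def sinAmp (C₁ C₂ : ℂ) (n r : ℕ) (z : ℝ) : ℂ :=
  Complex.I / 2 * ((C₂ - Complex.I * C₁) ^ (n - r) * (C₂ + Complex.I * C₁) ^ r) *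
      oscAmp r (n - r) z +
    -Complex.I / 2 * ((C₂ + Complex.I * C₁) ^ (n - r) * (C₂ - Complex.I * C₁) ^ r) *
      (starRingEnd ℂ) (oscAmp r (n - r) z)

theorem tauTerm_add_tauTerm (C₁ C₂ : ℂ) {n r : ℕ} (hr : r ≤ n) {z : ℝ} (hz : 0 < z) :
    tauTerm C₁ C₂ n r z + tauTerm C₁ C₂ n (n - r) z =
      2 * (tauConst n : ℂ) * ((z ^ (-((n : ℝ) ^ 2 / 4)) : ℝ) : ℂ) *
        (cosAmp C₁ C₂ n r z * (Real.cos (oscPhase n r z) : ℂ) +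
          sinAmp C₁ C₂ n r z * (Real.sin (oscPhase n r z) : ℂ)) := by
  obtain ⟨m, rfl⟩ := Nat.exists_eq_add_of_le hr
  rw [Nat.add_sub_cancel_left, tauTerm_swap, tauTerm_eq _ _ _ _ hz, tauTerm_eq _ _ _ _ hz]
  simp only [map_mul, map_pow, map_sub, map_add, Complex.conj_ofReal, Complex.conj_conj,
    Complex.conj_I, ← Complex.exp_conj, cosAmp, sinAmp, Nat.add_sub_cancel_left, mul_neg]
  rw [← mul_neg, Complex.exp_mul_I, show ((oscPhase (r + m) r z : ℝ) : ℂ) * -Complex.I =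
    (-(oscPhase (r + m) r z : ℝ) : ℂ) * Complex.I by ring, Complex.exp_mul_I, Complex.cos_neg,
    Complex.sin_neg, Complex.ofReal_cos, Complex.ofReal_sin]
  ring

theorem exists_hasOscExpansion_cosAmp_sinAmp (C₁ C₂ : ℂ) (n r : ℕ) :
    ∃ b d : ℕ → ℂ, 2 * r ≤ n →
      HasOscExpansion (cosAmp C₁ C₂ n r) (oscConst n r) (3 / 2 * (r : ℝ) * ((n : ℝ) - (r : ℝ))) b ∧
      HasOscExpansion (sinAmp C₁ C₂ n r) (oscConst n r) (3 / 2 * (r : ℝ) * ((n : ℝ) - (r : ℝ))) d ∧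
      b 0 = oscB0 C₁ C₂ n r ∧ d 0 = oscD0 C₁ C₂ n r := by
  by_cases hrn : 2 * r ≤ n
  swap
  · exact ⟨0, 0, fun h => absurd h hrn⟩
  obtain ⟨m, rfl⟩ := Nat.exists_eq_add_of_le (show r ≤ n by omega)
  obtain ⟨c, hc0, hc⟩ := exists_hasOscExpansion_oscAmp (show r ≤ m by omega)
  have hI : Complex.I ^ 2 = -1 := Complex.I_sq
  have h1 := add_pow_mul_sub_pow_of_sq C₁ C₂ hI r m
  have h2 := add_pow_mul_sub_pow_of_sq C₁ C₂ (show (-Complex.I) ^ 2 = -1 by rw [neg_sq, hI]) r m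
  rw [neg_mul, neg_mul, ← sub_eq_add_neg, sub_neg_eq_add, sub_neg_eq_add] at h2
  have hcos := (hc.const_mul
    (1 / 2 * ((C₂ - Complex.I * C₁) ^ m * (C₂ + Complex.I * C₁) ^ r))).add
    (hc.conj.const_mul (1 / 2 * ((C₂ + Complex.I * C₁) ^ m * (C₂ - Complex.I * C₁) ^ r)))
  have hsin := (hc.const_mul
    (Complex.I / 2 * ((C₂ - Complex.I * C₁) ^ m * (C₂ + Complex.I * C₁) ^ r))).add
    (hc.conj.const_mul (-Complex.I / 2 * ((C₂ + Complex.I * C₁) ^ m * (C₂ - Complex.I * C₁) ^ r)))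
  have ecos : cosAmp C₁ C₂ (r + m) r = fun z =>
      1 / 2 * ((C₂ - Complex.I * C₁) ^ m * (C₂ + Complex.I * C₁) ^ r) * oscAmp r m z +
        1 / 2 * ((C₂ + Complex.I * C₁) ^ m * (C₂ - Complex.I * C₁) ^ r) *
          (starRingEnd ℂ) (oscAmp r m z) := by
    unfold cosAmp; rw [Nat.add_sub_cancel_left]
  have esin : sinAmp C₁ C₂ (r + m) r = fun z =>
      Complex.I / 2 * ((C₂ - Complex.I * C₁) ^ m * (C₂ + Complex.I * C₁) ^ r) * oscAmp r m z +
        -Complex.I / 2 * ((C₂ + Complex.I * C₁) ^ m * (C₂ - Complex.I * C₁) ^ r) *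
          (starRingEnd ℂ) (oscAmp r m z) := by
    unfold sinAmp; rw [Nat.add_sub_cancel_left]
  rw [← ecos] at hcos
  rw [← esin] at hsin
  refine ⟨_, _, fun _ => ⟨hcos, hsin, ?_, ?_⟩⟩
  · simp only [hc0, map_one]
    linear_combination (1 / 2 : ℂ) * h1 + (1 / 2 : ℂ) * h2
  · simp only [hc0, map_one]
    linear_combination (Complex.I / 2) * h1 - (Complex.I / 2) * h2 -
      oscD0 C₁ C₂ (r + m) r * Complex.I_sq

theorem sum_range_two_mul_eq_pairs (t : ℕ → ℂ) (s : ℕ) :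
    ∑ r ∈ Finset.range (2 * s), t r = ∑ r ∈ Finset.range s, (t r + t (2 * s - 1 - r)) := by
  rw [two_mul, Finset.sum_range_add, Finset.sum_add_distrib,
    ← Finset.sum_range_reflect (fun x => t (s + x))]
  congr 1
  refine Finset.sum_congr rfl fun r hr => ?_
  have := Finset.mem_range.1 hr
  congr 1
  omega

theorem sum_range_two_mul_add_one_eq_pairs (t : ℕ → ℂ) (s : ℕ) :
    ∑ r ∈ Finset.range (2 * s + 1), t r =
      t s + ∑ r ∈ Finset.range s, (t r + t (2 * s - r)) := by
  rw [show 2 * s + 1 = s + (1 + s) by ring, Finset.sum_range_add, Finset.sum_range_add,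
    Finset.sum_add_distrib, ← Finset.sum_range_reflect (fun x => t (s + (1 + x)))]
  have h : ∑ j ∈ Finset.range s, t (s + (1 + (s - 1 - j))) =
      ∑ r ∈ Finset.range s, t (2 * s - r) := by
    refine Finset.sum_congr rfl fun r hr => ?_
    have := Finset.mem_range.1 hr
    congr 1
    omega
  rw [h, Finset.sum_range_one, add_zero]
  ring

end Trig

theorem theorem2p5 (C₁ C₂ : ℂ) :
    ∃ (B D : ℕ → ℕ → ℝ → ℂ) (b d : ℕ → ℕ → ℕ → ℂ),
      -- the full asymptotic expansions of the coefficient functions, with their leading terms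
      (∀ n r : ℕ, 1 ≤ n → 2 * r ≤ n →
        HasOscExpansion (B n r) (oscConst n r) (3 / 2 * (r : ℝ) * ((n : ℝ) - (r : ℝ))) (b n r) ∧
        HasOscExpansion (D n r) (oscConst n r) (3 / 2 * (r : ℝ) * ((n : ℝ) - (r : ℝ))) (d n r) ∧
        b n r 0 = oscB0 C₁ C₂ n r ∧
        d n r 0 = oscD0 C₁ C₂ n r) ∧
      -- the tau functions of even and of odd index
      (∀ s : ℕ, 1 ≤ s → ∀ z : ℝ, 0 < z →
        airyTau C₁ C₂ (2 * s) (z : ℂ) =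
          (tauConst (2 * s) : ℂ) * ((z ^ (-((s : ℝ) ^ 2)) : ℝ) : ℂ) *
            (B (2 * s) s z +
              2 * ∑ r ∈ Finset.range s,
                (B (2 * s) r z * (Real.cos (oscPhase (2 * s) r z) : ℂ) +
                  D (2 * s) r z * (Real.sin (oscPhase (2 * s) r z) : ℂ))) ∧
        airyTau C₁ C₂ (2 * s - 1) (z : ℂ) =
          2 * (tauConst (2 * s - 1) : ℂ) *
            ((z ^ (-((2 * (s : ℝ) - 1) ^ 2 / 4)) : ℝ) : ℂ) *
            ∑ r ∈ Finset.range s,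
              (B (2 * s - 1) r z * (Real.cos (oscPhase (2 * s - 1) r z) : ℂ) +
                D (2 * s - 1) r z * (Real.sin (oscPhase (2 * s - 1) r z) : ℂ))) := by
  choose b d hbd using exists_hasOscExpansion_cosAmp_sinAmp C₁ C₂
  refine ⟨cosAmp C₁ C₂, sinAmp C₁ C₂, b, d, fun n r _ hr => hbd n r hr, fun s hs z hz => ⟨?_, ?_⟩⟩
  · rw [airyTau_eq_sum_tauTerm C₁ C₂ _ hz, sum_range_two_mul_add_one_eq_pairs]
    have hz2 : (-((s : ℝ) ^ 2)) = -(((2 * s : ℕ) : ℝ) ^ 2 / 4) := by push_cast; ring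
    -- the middle term is half of the pair that it forms with itself, and its phase is `0`
    have hmid := tauTerm_add_tauTerm C₁ C₂ (show s ≤ 2 * s by omega) hz
    have hψ : oscPhase (2 * s) s z = 0 := by
      rw [oscPhase]; push_cast; ring
    rw [show 2 * s - s = s by omega, hψ, Real.cos_zero, Real.sin_zero] at hmid
    have hsum : ∑ r ∈ Finset.range s,
        (tauTerm C₁ C₂ (2 * s) r z + tauTerm C₁ C₂ (2 * s) (2 * s - r) z) = _ :=
      Finset.sum_congr rfl fun r hr => tauTerm_add_tauTerm C₁ C₂
        (by have := Finset.mem_range.1 hr; omega) hz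
    rw [hsum, ← Finset.mul_sum, hz2]
    push_cast at hmid ⊢
    linear_combination (1 / 2 : ℂ) * hmid
  · rw [airyTau_eq_sum_tauTerm C₁ C₂ _ hz, show 2 * s - 1 + 1 = 2 * s by omega,
      sum_range_two_mul_eq_pairs]
    have hz2 : (-((2 * (s : ℝ) - 1) ^ 2 / 4)) = -(((2 * s - 1 : ℕ) : ℝ) ^ 2 / 4) := by
      rw [Nat.cast_sub (by omega)]; push_cast; ring
    rw [hz2, Finset.mul_sum]
    exact Finset.sum_congr rfl fun r hr => tauTerm_add_tauTerm C₁ C₂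
      (by have := Finset.mem_range.1 hr; omega) hz
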